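/- Let $\mathcal V=(\mathcal V,\otimes,\mathbb 1)$ be a symmetric monoidal model category, i.e. a complete and cocomplete closed symmetric monoidal category with a model structure such that $\mathbb 1$ is cofibrant and, for all cofibrations $v\rightarrowtail v'$ and $w\rightarrowtail w'$, the pushout-product map $v\otimes w'\cup_{v\otimes w}v'\otimes w\to v'\otimes w'$ is a cofibration, which is a weak equivalence if one of $v\to v'$, $w\to w'$ is. Let $\mathcal N$ be a $\mathcal V$-model category, i.e. a $\mathcal V$-category that is $\mathcal V$-complete and $\mathcal V$-cocomplete (tensored and cotensored over $\mathcal V$, with complete and cocomplete underlying category), with a model structure on its underlying category such that for every cofibration $A\rightarrowtail B$ and every fibration $X\twoheadrightarrow Y$ in $\mathcal N$ the pullback-power map $\mathcal N(B,X)\to\mathcal N(B,Y)\times_{\mathcal N(A,Y)}\mathcal N(A,X)$ is a fibration in $\mathcal V$, which is a weak equivalence if one of $A\to B$, $X\to Y$ is. Let $\mathcal C$ be a small $\mathcal V$-category. For $\mathcal V$-functors $F\colon\mathcal C^{op}\to\mathcal V$ and $G\colon\mathcal C\to\mathcal N$, the simplicial bar construction $B_\bullet(F,\mathcal C,G)$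 is the simplicial object of $\mathcal N$ with $$B_n(F,\mathcal C,G)=\coprod_{c_0,\dots,c_n\in\mathcal C}F(c_n)\otimes\mathcal C(c_{n-1},c_n)\otimes\cdots\otimes\mathcal C(c_0,c_1)\otimes G(c_0),$$ where the inner face maps are given by composition in $\mathcal C$, the two outer face maps by the actions $\mathcal C(c_0,c_1)\otimes G(c_0)\to G(c_1)$ and $F(c_n)\otimes\mathcal C(c_{n-1},c_n)\to F(c_{n-1})$, and the degeneracies by the unit maps $\mathbb 1\to\mathcal C(c,c)$. Suppose that all hom-objects $\mathcal C(c,d)$ are cofibrant in $\mathcal V$ and that the unit map $\mathbb 1\to\mathcal C(c,c)$ is a cofibration in $\mathcal V$ for every object $c$ of $\mathcal C$. Let $F\to F'$ be a $\mathcal V$-natural transformation of $\mathcal V$-functors $\mathcal C^{op}\to\mathcal V$ such that $F(c)\to F'(c)$ is a cofibration for every $c$, and let $G\colon\mathcal C\to\mathcal N$ be a $\mathcal V$-functor such that $G(c)$ is cofibrant for every $c$. Then the induced map $$B_\bullet(F,\mathcal C,G)\to B_\bullet(F',\mathcal C,G)$$ is a Reedy cofibration of simplicial objects in $\mathcal N$;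 that is, for every $n\ge 0$ the relative latching map $$B_n(F,\mathcal C,G)\cup_{L_nB_\bullet(F,\mathcal C,G)}L_nB_\bullet(F',\mathcal C,G)\to B_n(F',\mathcal C,G)$$ is a cofibration in $\mathcal N$, where $L_nX=\operatorname{colim}_{[n]\twoheadrightarrow[k],\,k<n}X_k$ denotes the $n$-th latching object of a simplicial object $X$. -/

import Mathlib

set_option linter.unusedSectionVars false

open CategoryTheory Limits MonoidalCategory Opposite HomotopicalAlgebra
open scoped MonoidalClosed

universe w v₁ v₂ u₁ u₂

namespace EnrichedBar

noncomputable section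

section Enriched

variable (V : Type u₁) [Category.{v₁} V] [MonoidalCategory V]

/-- A `V`-natural transformation between `V`-functors with values in a `V`-category `E` (with
underlying category `E`): components `F c ⟶ F' c` such that the square
`C(c, d) ⟶ E(F c, F' d)` in `V` commutes. (Mathlib's morphisms of `EnrichedFunctor`s are only
required to be natural on the underlying categories, which is weaker in general.) -/
structure VNatTrans {C : Type w} [EnrichedCategory V C] {E : Type u₂} [Category.{v₂} E]
    [EnrichedOrdinaryCategory V E] (F F' : EnrichedFunctor V C E) where
  app (c : C) : F.obj c ⟶ F'.obj c
  naturality (c d : C) :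
    F.map c d ≫ eHomWhiskerLeft V (F.obj c) (app d) =
      F'.map c d ≫ eHomWhiskerRight V (app c) (F'.obj d)

/-- A tensor of `x : N` by `v : V`: an object `v ⊗ x` with isomorphisms
`N(v ⊗ x, y) ≅ [v, N(x, y)]` that are `V`-natural in `y`, i.e. compatible with postcomposition
`N(-, y) ⊗ N(y, z) ⟶ N(-, z)` (stated after transposing along `v ⊗ - ⊣ [v, -]`). -/
structure TensorData [MonoidalClosed V] {N : Type u₂} [Category.{v₂} N]
    [EnrichedOrdinaryCategory V N] (v : V) (x : N) where
  obj : N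
  homIso (y : N) : (obj ⟶[V] y) ≅ (ihom v).obj (x ⟶[V] y)
  homIso_natural (y z : N) :
    MonoidalClosed.uncurry (eComp V obj y z ≫ (homIso z).hom) =
      (α_ v (obj ⟶[V] y) (y ⟶[V] z)).inv ≫
        MonoidalClosed.uncurry (homIso y).hom ▷ (y ⟶[V] z) ≫ eComp V x y z

/-- A cotensor of `y : N` by `v : V`: an object `y ^ v` with isomorphisms
`N(x, y ^ v) ≅ [v, N(x, y)]` that are `V`-natural in `x`, i.e. compatible with precomposition
`N(w, x) ⊗ N(x, -) ⟶ N(w, -)`. -/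
structure CotensorData [BraidedCategory V] [MonoidalClosed V] {N : Type u₂} [Category.{v₂} N]
    [EnrichedOrdinaryCategory V N] (v : V) (y : N) where
  obj : N
  homIso (x : N) : (x ⟶[V] obj) ≅ (ihom v).obj (x ⟶[V] y)
  homIso_natural (w x : N) :
    MonoidalClosed.uncurry (eComp V w x obj ≫ (homIso w).hom) =
      (α_ v (w ⟶[V] x) (x ⟶[V] obj)).inv ≫ (β_ v (w ⟶[V] x)).hom ▷ (x ⟶[V] obj) ≫
        (α_ (w ⟶[V] x) v (x ⟶[V] obj)).hom ≫
          (w ⟶[V] x) ◁ MonoidalClosed.uncurry (homIso x).hom ≫ eComp V w x y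

end Enriched

section Chains

variable {V : Type u₁} [Category.{v₁} V] [MonoidalCategory V] [SymmetricCategory V]
  [MonoidalClosed V] {C : Type w} [EnrichedCategory V C]

variable (V) in
/-- Composition of a `V`-category in the classical order `C(y, z) ⊗ C(x, y) ⟶ C(x, z)`. -/
def homComp (x y z : C) : (y ⟶[V] z) ⊗ (x ⟶[V] y) ⟶ (x ⟶[V] z) :=
  (β_ (y ⟶[V] z) (x ⟶[V] y)).hom ≫ eComp V x y z

variable (F F' : EnrichedFunctor V Cᵒᵖ V)

lemma uncurry_comp_uncurry {A B D X Y : V} (f : Y ⟶ (ihom A).obj B) (g : X ⟶ (ihom B).obj D) :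
    MonoidalClosed.uncurry f ▷ X ≫ MonoidalClosed.uncurry g =
      (α_ A Y X).hom ≫ MonoidalClosed.uncurry ((f ⊗ₘ g) ≫ MonoidalClosed.comp A B D) := by
  rw [MonoidalClosed.uncurry_natural_left, MonoidalClosed.comp_eq,
    MonoidalClosed.uncurry_curry, MonoidalClosed.compTranspose_eq]
  simp only [MonoidalClosed.uncurry_eq, MonoidalCategory.tensorHom_def,
    MonoidalCategory.whiskerLeft_comp, comp_whiskerRight, Category.assoc]
  rw [associator_inv_naturality_right_assoc, associator_inv_naturality_middle_assoc,
    Iso.hom_inv_id_assoc, whisker_exchange_assoc]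
  rfl

/-- The action `F(y) ⊗ C(x, y) ⟶ F(x)` of a `V`-functor `F : Cᵒᵖ → V`. -/
def presheafAct (x y : C) : F.obj (op y) ⊗ (x ⟶[V] y) ⟶ F.obj (op x) :=
  MonoidalClosed.uncurry (F.map (op y) (op x))

lemma homComp_assoc (w x y z : C) :
    homComp V x y z ▷ (w ⟶[V] x) ≫ homComp V w x z =
      (α_ _ _ _).hom ≫ (y ⟶[V] z) ◁ homComp V w x y ≫ homComp V w y z := by
  have := EnrichedCategory.assoc (V := V) (op z) (op y) (op x) (op w)
  rw [Iso.inv_comp_eq] at this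
  exact this

lemma homComp_id (x y : C) :
    (ρ_ (x ⟶[V] y)).inv ≫ (x ⟶[V] y) ◁ eId V x ≫ homComp V x x y = 𝟙 _ :=
  EnrichedCategory.comp_id (V := V) (op y) (op x)

lemma id_homComp (x y : C) :
    (λ_ (x ⟶[V] y)).inv ≫ eId V y ▷ (x ⟶[V] y) ≫ homComp V x y y = 𝟙 _ :=
  EnrichedCategory.id_comp (V := V) (op y) (op x)

lemma presheafAct_id (x : C) : (ρ_ (F.obj (op x))).inv ≫ F.obj (op x) ◁ eId V x ≫ presheafAct F x x = 𝟙 _ := by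
  have h := F.map_id (op x)
  have h2 : F.obj (op x) ◁ eId V x ≫ presheafAct F x x = (ρ_ _).hom := by
    unfold presheafAct
    rw [← MonoidalClosed.uncurry_natural_left]
    erw [h]
    exact MonoidalClosed.uncurry_curry _
  rw [h2, Iso.inv_hom_id]

lemma presheafAct_comp (x y z : C) :
    presheafAct F y z ▷ (x ⟶[V] y) ≫ presheafAct F x y =
      (α_ _ _ _).hom ≫ F.obj (op z) ◁ homComp V x y z ≫ presheafAct F x z := by
  have h := F.map_comp (op z) (op y) (op x)
  have h2 : F.obj (op z) ◁ homComp V x y z ≫ presheafAct F x z =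
      MonoidalClosed.uncurry (homComp V x y z ≫ F.map (op z) (op x)) := by
    rw [MonoidalClosed.uncurry_natural_left]; rfl
  have h3 : homComp V x y z ≫ F.map (op z) (op x) =
      (F.map (op z) (op y) ⊗ₘ F.map (op y) (op x)) ≫
        MonoidalClosed.comp (F.obj (op z)) (F.obj (op y)) (F.obj (op x)) := h
  rw [h2, h3]
  exact uncurry_comp_uncurry _ _

/-- For `c = (c₀, …, cₙ)`, the object
`F(cₙ) ⊗ C(cₙ₋₁, cₙ) ⊗ ⋯ ⊗ C(c₀, c₁)` of `V` (bracketed to the left). -/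
def barCoeff : (n : ℕ) → (Fin (n + 1) → C) → V
  | 0, c => F.obj (op (c 0))
  | n + 1, c => barCoeff n (fun i => c i.succ) ⊗ (c 0 ⟶[V] c (Fin.succ 0))

/-- For `c = (c₀, …, cₙ)` and `i ≤ n`, the object
`Uᵢ = F(cₙ) ⊗ C(cₙ₋₁, cₙ) ⊗ ⋯ ⊗ C(cᵢ, cᵢ₊₁)`, that is, `barCoeff` of `(cᵢ, …, cₙ)`. -/
def tailCoeff : (n : ℕ) → (c : Fin (n + 1) → C) → Fin (n + 1) → V
  | 0, c, _ => barCoeff F 0 c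
  | n + 1, c, i =>
      Fin.cases (barCoeff F (n + 1) c) (fun i => tailCoeff n (fun k => c k.succ) i) i

/-- The morphism `U₀ ⟶ Uⱼ ⊗ C(c₀, cⱼ)` that composes the factors
`C(cⱼ₋₁, cⱼ), …, C(c₀, c₁)`; for `j = 0` it inserts the identity `𝟙 ⟶ C(c₀, c₀)`. -/
def split₀ : (n : ℕ) → (c : Fin (n + 1) → C) → (j : Fin (n + 1)) →
    (barCoeff F n c ⟶ tailCoeff F n c j ⊗ (c 0 ⟶[V] c j))
  | 0, c, j =>
      Fin.cases (motive := fun j => barCoeff F 0 c ⟶ tailCoeff F 0 c j ⊗ (c 0 ⟶[V] c j))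
        ((ρ_ (barCoeff F 0 c)).inv ≫ barCoeff F 0 c ◁ eId V (c 0)) (fun j => j.elim0) j
  | n + 1, c, j =>
      Fin.cases
        (motive := fun j => barCoeff F (n + 1) c ⟶ tailCoeff F (n + 1) c j ⊗ (c 0 ⟶[V] c j))
        ((ρ_ (barCoeff F (n + 1) c)).inv ≫ barCoeff F (n + 1) c ◁ eId V (c 0))
        (fun j => split₀ n (fun k => c k.succ) j ▷ (c 0 ⟶[V] c (Fin.succ 0)) ≫
          (α_ _ _ _).hom ≫ tailCoeff F n (fun k => c k.succ) j ◁
            homComp V (c 0) (c (Fin.succ 0)) (c j.succ)) j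

/-- The morphism `Uᵢ ⟶ Uⱼ ⊗ C(cᵢ, cⱼ)` for `i ≤ j` that composes the factors
`C(cⱼ₋₁, cⱼ), …, C(cᵢ, cᵢ₊₁)`; for `i = j` it inserts the identity `𝟙 ⟶ C(cᵢ, cᵢ)`. -/
def split : (n : ℕ) → (c : Fin (n + 1) → C) → (i j : Fin (n + 1)) → i ≤ j →
    (tailCoeff F n c i ⟶ tailCoeff F n c j ⊗ (c i ⟶[V] c j))
  | 0, c, i, j, _ =>
      Fin.cases (motive := fun i => tailCoeff F 0 c i ⟶ tailCoeff F 0 c j ⊗ (c i ⟶[V] c j))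
        (split₀ F 0 c j) (fun i => i.elim0) i
  | n + 1, c, i, j, h =>
      Fin.cases
        (motive := fun i => i ≤ j →
          (tailCoeff F (n + 1) c i ⟶ tailCoeff F (n + 1) c j ⊗ (c i ⟶[V] c j)))
        (fun _ => split₀ F (n + 1) c j)
        (fun i => Fin.cases
          (motive := fun j => i.succ ≤ j →
            (tailCoeff F (n + 1) c i.succ ⟶ tailCoeff F (n + 1) c j ⊗ (c i.succ ⟶[V] c j)))
          (fun h => absurd h (Fin.not_le.2 i.succ_pos))
          (fun j h => split n (fun k => c k.succ) i j (Fin.succ_le_succ_iff.1 h)) j) i h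

/-- The morphism `U₀ ⟶ F(c₀)` given by letting all factors act on `F`. -/
def collapse₀ : (n : ℕ) → (c : Fin (n + 1) → C) → (barCoeff F n c ⟶ F.obj (op (c 0)))
  | 0, _ => 𝟙 _
  | n + 1, c => collapse₀ n (fun k => c k.succ) ▷ (c 0 ⟶[V] c (Fin.succ 0)) ≫
      presheafAct F (c 0) (c (Fin.succ 0))

/-- The morphism `Uᵢ ⟶ F(cᵢ)` given by letting all factors act on `F`. -/
def collapse : (n : ℕ) → (c : Fin (n + 1) → C) → (i : Fin (n + 1)) →
    (tailCoeff F n c i ⟶ F.obj (op (c i)))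
  | 0, c, i => Fin.cases (motive := fun i => tailCoeff F 0 c i ⟶ F.obj (op (c i)))
      (collapse₀ F 0 c) (fun i => i.elim0) i
  | n + 1, c, i => Fin.cases (motive := fun i => tailCoeff F (n + 1) c i ⟶ F.obj (op (c i)))
      (collapse₀ F (n + 1) c) (fun i => collapse n (fun k => c k.succ) i) i

/-- The restriction of `φ : [m + 1] → [n]` to the vertices `1, …, m + 1`. -/
def ordTail {m n : ℕ} (φ : Fin (m + 2) →o Fin (n + 1)) : Fin (m + 1) →o Fin (n + 1) where
  toFun i := φ i.succ
  monotone' _ _ h := φ.monotone (Fin.succ_le_succ_iff.2 h)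

/-- For `φ : [m] → [n]`, the morphism from `U_{φ 0}` (for `c`) to `barCoeff` of `c ∘ φ`: it composes
the factors between `φ i` and `φ (i + 1)` (inserting an identity if they agree), and lets the
factors above `φ m` act on `F`. -/
def reindex₀ {n : ℕ} (c : Fin (n + 1) → C) : (m : ℕ) → (φ : Fin (m + 1) →o Fin (n + 1)) →
    (tailCoeff F n c (φ 0) ⟶ barCoeff F m (fun i => c (φ i)))
  | 0, φ => collapse F n c (φ 0)
  | m + 1, φ => split F n c (φ 0) (φ (Fin.succ 0)) (φ.monotone (Fin.zero_le _)) ≫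
      reindex₀ c m (ordTail φ) ▷ (c (φ 0) ⟶[V] c (φ (Fin.succ 0)))

/-- The analogue of `reindex₀` for the vertices `i, …, m` of `φ : [m] → [n]`. -/
def reindex {n : ℕ} (c : Fin (n + 1) → C) : (m : ℕ) → (φ : Fin (m + 1) →o Fin (n + 1)) →
    (i : Fin (m + 1)) → (tailCoeff F n c (φ i) ⟶ tailCoeff F m (fun i => c (φ i)) i)
  | 0, φ, i => Fin.cases
      (motive := fun i => tailCoeff F n c (φ i) ⟶ tailCoeff F 0 (fun i => c (φ i)) i)
      (reindex₀ F c 0 φ) (fun i => i.elim0) i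
  | m + 1, φ, i => Fin.cases
      (motive := fun i => tailCoeff F n c (φ i) ⟶ tailCoeff F (m + 1) (fun i => c (φ i)) i)
      (reindex₀ F c (m + 1) φ) (fun i => reindex c m (ordTail φ) i) i

lemma unit_step (A : V) (x y : C) :
    ((ρ_ A).inv ≫ A ◁ eId V y) ▷ (x ⟶[V] y) ≫ (α_ _ _ _).hom ≫ A ◁ homComp V x y y = 𝟙 _ := by
  have h := id_homComp (V := V) x y
  have : (ρ_ A).inv ▷ (x ⟶[V] y) ≫ (α_ _ _ _).hom = A ◁ (λ_ _).inv := by monoidal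
  rw [comp_whiskerRight, Category.assoc, associator_naturality_middle_assoc,
    reassoc_of% this, ← MonoidalCategory.whiskerLeft_comp, ← MonoidalCategory.whiskerLeft_comp, h,
    MonoidalCategory.whiskerLeft_id]

lemma step_unit {A B : V} (x y : C) (f : A ⟶ B ⊗ (x ⟶[V] y)) :
    ((ρ_ A).inv ≫ A ◁ eId V x) ≫ f ▷ (x ⟶[V] x) ≫ (α_ _ _ _).hom ≫ B ◁ homComp V x x y = f := by
  have h := homComp_id (V := V) x y
  have h2 : (ρ_ (B ⊗ (x ⟶[V] y))).inv ≫ (B ⊗ (x ⟶[V] y)) ◁ eId V x ≫ (α_ _ _ _).hom =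
    B ◁ ((ρ_ _).inv ≫ (x ⟶[V] y) ◁ eId V x) := by monoidal
  rw [Category.assoc, whisker_exchange_assoc, ← rightUnitor_inv_naturality_assoc,
    reassoc_of% h2, ← MonoidalCategory.whiskerLeft_comp, Category.assoc, h,
    MonoidalCategory.whiskerLeft_id, Category.comp_id]

lemma step_assoc (B : V) (w x y z : C) :
    ((α_ B (y ⟶[V] z) (x ⟶[V] y)).hom ≫ B ◁ homComp V x y z) ▷ (w ⟶[V] x) ≫
        (α_ _ _ _).hom ≫ B ◁ homComp V w x z =
      (α_ _ _ _).hom ≫ (B ⊗ (y ⟶[V] z)) ◁ homComp V w x y ≫ (α_ _ _ _).hom ≫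
        B ◁ homComp V w y z := by
  have h := homComp_assoc (V := V) w x y z
  rw [comp_whiskerRight, Category.assoc, associator_naturality_middle_assoc,
    ← MonoidalCategory.whiskerLeft_comp, h]
  simp

lemma split_self (n : ℕ) (c : Fin (n + 1) → C) (i : Fin (n + 1)) :
    split F n c i i le_rfl = (ρ_ _).inv ≫ tailCoeff F n c i ◁ eId V (c i) := by
  induction n with
  | zero => cases i using Fin.cases with
    | zero => rfl
    | succ i => exact i.elim0
  | succ n ih => cases i using Fin.cases with
    | zero => rfl
    | succ i => exact ih (fun k => c k.succ) i

lemma split₀_split (n : ℕ) (c : Fin (n + 1) → C) (j k : Fin (n + 1)) (h : j ≤ k) :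
    split₀ F n c k = split₀ F n c j ≫ split F n c j k h ▷ (c 0 ⟶[V] c j) ≫ (α_ _ _ _).hom ≫
      tailCoeff F n c k ◁ homComp V (c 0) (c j) (c k) := by
  induction n with
  | zero =>
    cases j using Fin.cases with
    | zero => exact (step_unit _ _ (split₀ F 0 c k)).symm
    | succ i => exact i.elim0
  | succ n ih =>
    cases j using Fin.cases with
    | zero => exact (step_unit _ _ (split₀ F (n + 1) c k)).symm
    | succ j =>
      cases k using Fin.cases with
      | zero => exact absurd h (Fin.not_le.2 j.succ_pos)
      | succ k =>
        have ih' := ih (fun k => c k.succ) j k (Fin.succ_le_succ_iff.1 h)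
        change split₀ F n (fun k => c k.succ) k ▷ (c 0 ⟶[V] c (Fin.succ 0)) ≫
          (α_ _ _ _).hom ≫ tailCoeff F n (fun k => c k.succ) k ◁
            homComp V (c 0) (c (Fin.succ 0)) (c k.succ) =
          (split₀ F n (fun k => c k.succ) j ▷ (c 0 ⟶[V] c (Fin.succ 0)) ≫
          (α_ _ _ _).hom ≫ tailCoeff F n (fun k => c k.succ) j ◁
            homComp V (c 0) (c (Fin.succ 0)) (c j.succ)) ≫
            split F n (fun k => c k.succ) j k (Fin.succ_le_succ_iff.1 h) ▷ (c 0 ⟶[V] c j.succ) ≫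
            (α_ _ _ _).hom ≫ tailCoeff F n (fun k => c k.succ) k ◁
              homComp V (c 0) (c j.succ) (c k.succ)
        rw [ih', comp_whiskerRight, Category.assoc, Category.assoc, Category.assoc,
          comp_whiskerRight, Category.assoc, step_assoc, whisker_exchange_assoc,
          associator_naturality_left_assoc]

lemma split_split (n : ℕ) (c : Fin (n + 1) → C) (i j k : Fin (n + 1)) (h₁ : i ≤ j) (h : j ≤ k) :
    split F n c i k (h₁.trans h) = split F n c i j h₁ ≫ split F n c j k h ▷ (c i ⟶[V] c j) ≫
      (α_ _ _ _).hom ≫ tailCoeff F n c k ◁ homComp V (c i) (c j) (c k) := by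
  induction n with
  | zero =>
    cases i using Fin.cases with
    | zero => exact split₀_split F 0 c j k h
    | succ i => exact i.elim0
  | succ n ih =>
    cases i using Fin.cases with
    | zero => exact split₀_split F (n + 1) c j k h
    | succ i =>
      cases j using Fin.cases with
      | zero => exact absurd h₁ (Fin.not_le.2 i.succ_pos)
      | succ j =>
        cases k using Fin.cases with
        | zero => exact absurd h (Fin.not_le.2 j.succ_pos)
        | succ k => exact ih (fun k => c k.succ) i j k _ _

lemma split₀_collapse (n : ℕ) (c : Fin (n + 1) → C) (j : Fin (n + 1)) :
    split₀ F n c j ≫ collapse F n c j ▷ (c 0 ⟶[V] c j) ≫ presheafAct F (c 0) (c j) =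
      collapse₀ F n c := by
  have key (A : V) (x : C) (f : A ⟶ F.obj (op x)) :
      ((ρ_ A).inv ≫ A ◁ eId V x) ≫ f ▷ (x ⟶[V] x) ≫ presheafAct F x x = f := by
    rw [Category.assoc, whisker_exchange_assoc, ← rightUnitor_inv_naturality_assoc, presheafAct_id,
      Category.comp_id]
  induction n with
  | zero =>
    cases j using Fin.cases with
    | zero => exact key _ _ _
    | succ i => exact i.elim0
  | succ n ih =>
    cases j using Fin.cases with
    | zero => exact key _ _ _
    | succ j =>
      have ih' := ih (fun k => c k.succ) j
      change (split₀ F n (fun k => c k.succ) j ▷ (c 0 ⟶[V] c (Fin.succ 0)) ≫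
          (α_ _ _ _).hom ≫ tailCoeff F n (fun k => c k.succ) j ◁
            homComp V (c 0) (c (Fin.succ 0)) (c j.succ)) ≫
            collapse F n (fun k => c k.succ) j ▷ (c 0 ⟶[V] c j.succ) ≫
              presheafAct F (c 0) (c j.succ) =
            collapse₀ F n (fun k => c k.succ) ▷ (c 0 ⟶[V] c (Fin.succ 0)) ≫
              presheafAct F (c 0) (c (Fin.succ 0))
      rw [← ih', comp_whiskerRight, comp_whiskerRight, Category.assoc, Category.assoc,
        Category.assoc, Category.assoc, presheafAct_comp, whisker_exchange_assoc,
        associator_naturality_left_assoc]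

lemma split_collapse (n : ℕ) (c : Fin (n + 1) → C) (i j : Fin (n + 1)) (h : i ≤ j) :
    split F n c i j h ≫ collapse F n c j ▷ (c i ⟶[V] c j) ≫ presheafAct F (c i) (c j) =
      collapse F n c i := by
  induction n with
  | zero =>
    cases i using Fin.cases with
    | zero => exact split₀_collapse F 0 c j
    | succ i => exact i.elim0
  | succ n ih =>
    cases i using Fin.cases with
    | zero => exact split₀_collapse F (n + 1) c j
    | succ i =>
      cases j using Fin.cases with
      | zero => exact absurd h (Fin.not_le.2 i.succ_pos)
      | succ j => exact ih (fun k => c k.succ) i j _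

lemma reindex_aux {A B D W T X Y Z : V} (s₁ : A ⟶ B ⊗ X) (t : B ⟶ W) (s₂ : W ⟶ T ⊗ Y)
    (s₃ : B ⟶ D ⊗ Y) (r : D ⟶ T) (m : Y ⊗ X ⟶ Z) (h : t ≫ s₂ = s₃ ≫ r ▷ Y) :
    (s₁ ≫ t ▷ X) ≫ s₂ ▷ X ≫ (α_ T Y X).hom ≫ T ◁ m =
      (s₁ ≫ s₃ ▷ X ≫ (α_ D Y X).hom ≫ D ◁ m) ≫ r ▷ Z := by
  rw [Category.assoc, ← comp_whiskerRight_assoc, h]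
  simp only [comp_whiskerRight, Category.assoc]
  rw [whisker_exchange, associator_naturality_left_assoc]

lemma collapse_aux {A B W T X Y : V} (s₁ : A ⟶ B ⊗ X) (t : B ⟶ W) (e : W ⟶ T)
    (e' : B ⟶ T) (a : T ⊗ X ⟶ Y) (h : t ≫ e = e') :
    (s₁ ≫ t ▷ X) ≫ e ▷ X ≫ a = s₁ ≫ e' ▷ X ≫ a := by
  rw [Category.assoc, ← comp_whiskerRight_assoc, h]

lemma reindex_comp_aux {A A' B B' W X : V} (u : A ⟶ A') (s : A' ⟶ B' ⊗ X) (t : B' ⟶ W)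
    (s' : A ⟶ B ⊗ X) (u' : B ⟶ B') (t' : B ⟶ W) (h : u ≫ s = s' ≫ u' ▷ X) (h' : u' ≫ t = t') :
    u ≫ s ≫ t ▷ X = s' ≫ t' ▷ X := by
  rw [reassoc_of% h, ← h', comp_whiskerRight]

lemma reindex₀_split₀ {n : ℕ} (c : Fin (n + 1) → C) (m : ℕ) (φ : Fin (m + 1) →o Fin (n + 1))
    (j : Fin (m + 1)) :
    reindex₀ F c m φ ≫ split₀ F m (fun i => c (φ i)) j =
      split F n c (φ 0) (φ j) (φ.monotone (Fin.zero_le _)) ≫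
        reindex F c m φ j ▷ (c (φ 0) ⟶[V] c (φ j)) := by
  have key (A B : V) (x : C) (f : A ⟶ B) :
      f ≫ ((ρ_ B).inv ≫ B ◁ eId V x) = ((ρ_ A).inv ≫ A ◁ eId V x) ≫ f ▷ (x ⟶[V] x) := by
    rw [Category.assoc, whisker_exchange, ← rightUnitor_inv_naturality_assoc]
  induction m with
  | zero =>
    cases j using Fin.cases with
    | zero => rw [split_self]; exact key _ _ _ _
    | succ i => exact i.elim0
  | succ m ih =>
    cases j using Fin.cases with
    | zero => rw [split_self]; exact key _ _ _ _
    | succ j =>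
      have ih' := ih (ordTail φ) j
      change (split F n c (φ 0) (φ (Fin.succ 0)) (φ.monotone (Fin.zero_le _)) ≫
        reindex₀ F c m (ordTail φ) ▷ (c (φ 0) ⟶[V] c (φ (Fin.succ 0)))) ≫
          split₀ F m (fun i => c (φ i.succ)) j ▷ (c (φ 0) ⟶[V] c (φ (Fin.succ 0))) ≫
          (α_ _ _ _).hom ≫ tailCoeff F m (fun i => c (φ i.succ)) j ◁
            homComp V (c (φ 0)) (c (φ (Fin.succ 0))) (c (φ j.succ)) =
        split F n c (φ 0) (φ j.succ) (φ.monotone (Fin.zero_le _)) ≫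
          reindex F c m (ordTail φ) j ▷ (c (φ 0) ⟶[V] c (φ j.succ))
      rw [split_split F n c (φ 0) (φ (Fin.succ 0)) (φ j.succ) (φ.monotone (Fin.zero_le _))
        (φ.monotone (Fin.succ_le_succ_iff.2 (Fin.zero_le _)))]
      exact reindex_aux _ _ _ _ _ _ ih'

lemma reindex_split {n : ℕ} (c : Fin (n + 1) → C) (m : ℕ) (φ : Fin (m + 1) →o Fin (n + 1))
    (i j : Fin (m + 1)) (h : i ≤ j) :
    reindex F c m φ i ≫ split F m (fun i => c (φ i)) i j h =
      split F n c (φ i) (φ j) (φ.monotone h) ≫ reindex F c m φ j ▷ (c (φ i) ⟶[V] c (φ j)) := by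
  induction m with
  | zero =>
    cases i using Fin.cases with
    | zero => exact reindex₀_split₀ F c 0 φ j
    | succ i => exact i.elim0
  | succ m ih =>
    cases i using Fin.cases with
    | zero => exact reindex₀_split₀ F c (m + 1) φ j
    | succ i =>
      cases j using Fin.cases with
      | zero => exact absurd h (Fin.not_le.2 i.succ_pos)
      | succ j => exact ih (ordTail φ) i j _

lemma reindex₀_collapse {n : ℕ} (c : Fin (n + 1) → C) (m : ℕ) (φ : Fin (m + 1) →o Fin (n + 1)) :
    reindex₀ F c m φ ≫ collapse₀ F m (fun i => c (φ i)) = collapse F n c (φ 0) := by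
  induction m with
  | zero => exact Category.comp_id _
  | succ m ih =>
    have ih' := ih (ordTail φ)
    change (split F n c (φ 0) (φ (Fin.succ 0)) (φ.monotone (Fin.zero_le _)) ≫
      reindex₀ F c m (ordTail φ) ▷ (c (φ 0) ⟶[V] c (φ (Fin.succ 0)))) ≫
      collapse₀ F m (fun i => c (φ i.succ)) ▷ (c (φ 0) ⟶[V] c (φ (Fin.succ 0))) ≫
        presheafAct F (c (φ 0)) (c (φ (Fin.succ 0))) = _
    exact (collapse_aux _ _ _ _ _ ih').trans (split_collapse F n c _ _ _)

lemma reindex_collapse {n : ℕ} (c : Fin (n + 1) → C) (m : ℕ) (φ : Fin (m + 1) →o Fin (n + 1))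
    (i : Fin (m + 1)) :
    reindex F c m φ i ≫ collapse F m (fun i => c (φ i)) i = collapse F n c (φ i) := by
  induction m with
  | zero =>
    cases i using Fin.cases with
    | zero => exact reindex₀_collapse F c 0 φ
    | succ i => exact i.elim0
  | succ m ih =>
    cases i using Fin.cases with
    | zero => exact reindex₀_collapse F c (m + 1) φ
    | succ i => exact ih (ordTail φ) i

/-- The composition of `φ : [m] → [n]` with the inclusion `[n] → [n + 1]` omitting `0`. -/
def ordSucc {m n : ℕ} (φ : Fin (m + 1) →o Fin (n + 1)) : Fin (m + 1) →o Fin (n + 2) where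
  toFun i := (φ i).succ
  monotone' _ _ h := Fin.succ_le_succ_iff.2 (φ.monotone h)

lemma reindex₀_ordSucc {n : ℕ} (c : Fin (n + 2) → C) (m : ℕ) (φ : Fin (m + 1) →o Fin (n + 1)) :
    reindex₀ F c m (ordSucc φ) = reindex₀ F (fun i => c i.succ) m φ := by
  induction m with
  | zero => rfl
  | succ m ih =>
    have ih' := ih (ordTail φ)
    exact congrArg (fun f => split F n (fun i => c i.succ) (φ 0) (φ (Fin.succ 0))
      (φ.monotone (Fin.zero_le _)) ≫ f ▷ (c (φ 0).succ ⟶[V] c (φ (Fin.succ 0)).succ)) ih'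

lemma id_aux {A B : V} (x y : C) (s : A ⟶ B ⊗ (y ⟶[V] y)) (r : B ⟶ A)
    (h : s ≫ r ▷ (y ⟶[V] y) = (ρ_ A).inv ≫ A ◁ eId V y) :
    (s ▷ (x ⟶[V] y) ≫ (α_ _ _ _).hom ≫ B ◁ homComp V x y y) ≫ r ▷ (x ⟶[V] y) =
      𝟙 (A ⊗ (x ⟶[V] y)) := by
  rw [← unit_step A x y, ← h]
  simp only [comp_whiskerRight, Category.assoc]
  rw [whisker_exchange, associator_naturality_left_assoc]

lemma split₀_reindex₀_id (n : ℕ) (c : Fin (n + 1) → C) :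
    split₀ F n c 0 ≫ reindex₀ F c n OrderHom.id ▷ (c 0 ⟶[V] c 0) =
      (ρ_ (barCoeff F n c)).inv ≫ barCoeff F n c ◁ eId V (c 0) := by
  induction n with
  | zero =>
    change ((ρ_ (barCoeff F 0 c)).inv ≫ barCoeff F 0 c ◁ eId V (c 0)) ≫
      𝟙 (barCoeff F 0 c) ▷ (c 0 ⟶[V] c 0) = _
    rw [id_whiskerRight, Category.comp_id]
  | succ n ih =>
    have ih' := ih (fun k => c k.succ)
    have h : reindex₀ F c (n + 1) OrderHom.id = 𝟙 (barCoeff F (n + 1) c) := by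
      change (split₀ F n (fun k => c k.succ) 0 ▷ (c 0 ⟶[V] c (Fin.succ 0)) ≫
          (α_ _ _ _).hom ≫ tailCoeff F n (fun k => c k.succ) 0 ◁
            homComp V (c 0) (c (Fin.succ 0)) (c (Fin.succ 0))) ≫
          reindex₀ F c n (ordSucc OrderHom.id) ▷ (c 0 ⟶[V] c (Fin.succ 0)) = _
      rw [reindex₀_ordSucc]
      exact id_aux _ _ _ _ ih'
    exact (congrArg (fun f => ((ρ_ (barCoeff F (n + 1) c)).inv ≫ barCoeff F (n + 1) c ◁
      eId V (c 0)) ≫ f ▷ (c 0 ⟶[V] c 0)) h).trans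
        ((congrArg _ (id_whiskerRight _ _)).trans (Category.comp_id _))

lemma reindex₀_comp {n : ℕ} (c : Fin (n + 1) → C) {m : ℕ} (φ : Fin (m + 1) →o Fin (n + 1))
    (l : ℕ) (ψ : Fin (l + 1) →o Fin (m + 1)) :
    reindex F c m φ (ψ 0) ≫ reindex₀ F (fun i => c (φ i)) l ψ = reindex₀ F c l (φ.comp ψ) := by
  induction l with
  | zero => exact reindex_collapse F c m φ (ψ 0)
  | succ l ih =>
    have ih' := ih (ordTail ψ)
    change reindex F c m φ (ψ 0) ≫ split F m (fun i => c (φ i)) (ψ 0) (ψ (Fin.succ 0)) _ ≫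
      reindex₀ F (fun i => c (φ i)) l (ordTail ψ) ▷ (c (φ (ψ 0)) ⟶[V] c (φ (ψ (Fin.succ 0)))) =
      split F n c (φ (ψ 0)) (φ (ψ (Fin.succ 0))) _ ≫
        reindex₀ F c l (φ.comp (ordTail ψ)) ▷ (c (φ (ψ 0)) ⟶[V] c (φ (ψ (Fin.succ 0))))
    exact reindex_comp_aux _ _ _ _ _ _
      (reindex_split F c m φ (ψ 0) (ψ (Fin.succ 0)) (ψ.monotone (Fin.zero_le _))) ih'

end Chains

section Tensors

variable {V : Type u₁} [Category.{v₁} V] [MonoidalCategory V] [SymmetricCategory V]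
  [MonoidalClosed V] {N : Type u₂} [Category.{v₂} N] [EnrichedOrdinaryCategory V N]

/-- Morphisms `v ⊗ x ⟶ y` correspond to morphisms `v ⟶ N(x, y)`. -/
def TensorData.homEquiv {v : V} {x : N} (T : TensorData V v x) (y : N) :
    (v ⟶ (x ⟶[V] y)) ≃ (T.obj ⟶ y) :=
  MonoidalClosed.curryHomEquiv'.trans
    ((T.homIso y).symm.homToEquiv.trans (eHomEquiv V).symm)

lemma TensorData.homEquiv_symm_comp {v : V} {x : N} (T : TensorData V v x) {y z : N}
    (h : T.obj ⟶ y) (g : y ⟶ z) :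
    (T.homEquiv z).symm (h ≫ g) = (T.homEquiv y).symm h ≫ eHomWhiskerLeft V x g := by
  have key (z : N) (h : T.obj ⟶ z) : (T.homEquiv z).symm h =
      (ρ_ v).inv ≫ MonoidalClosed.uncurry (eHomEquiv V h ≫ (T.homIso z).hom) := rfl
  rw [key, key, eHomEquiv_comp, MonoidalCategory.tensorHom_def, Category.assoc, Category.assoc,
    Category.assoc, MonoidalClosed.uncurry_natural_left, MonoidalClosed.uncurry_natural_left,
    MonoidalClosed.uncurry_natural_left, T.homIso_natural, MonoidalClosed.uncurry_natural_left]
  simp only [eHomWhiskerLeft]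
  rw [associator_inv_naturality_right_assoc, associator_inv_naturality_middle_assoc,
    whisker_exchange_assoc]
  simp

lemma TensorData.homEquiv_comp {v : V} {x : N} (T : TensorData V v x) {y z : N}
    (f : v ⟶ (x ⟶[V] y)) (g : y ⟶ z) :
    T.homEquiv y f ≫ g = T.homEquiv z (f ≫ eHomWhiskerLeft V x g) := by
  rw [← Equiv.symm_apply_eq, T.homEquiv_symm_comp, Equiv.symm_apply_apply]

variable (V N) in
/-- `N` admits tensors by all objects of `V`. -/
class EnrichedTensored where
  tensor (v : V) (x : N) : TensorData V v x

variable (V N) in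
/-- `N` admits cotensors by all objects of `V`. -/
class EnrichedCotensored where
  cotensor (v : V) (y : N) : CotensorData V v y

variable [EnrichedTensored V N]

/-- The tensor `v ⊗ x` in `N`. -/
def vTensor (v : V) (x : N) : N := (EnrichedTensored.tensor v x).obj

/-- The bijection between morphisms `v ⟶ N(x, y)` and morphisms `v ⊗ x ⟶ y`. -/
def vTensorDesc {v : V} {x y : N} : (v ⟶ (x ⟶[V] y)) ≃ (vTensor v x ⟶ y) :=
  (EnrichedTensored.tensor v x).homEquiv y

/-- The universal morphism `v ⟶ N(x, v ⊗ x)`. -/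
def vTensorUnit (v : V) (x : N) : v ⟶ (x ⟶[V] vTensor v x) :=
  vTensorDesc.symm (𝟙 (vTensor v x))

lemma vTensorDesc_comp {v : V} {x y z : N} (f : v ⟶ (x ⟶[V] y)) (g : y ⟶ z) :
    vTensorDesc f ≫ g = vTensorDesc (f ≫ eHomWhiskerLeft V x g) :=
  TensorData.homEquiv_comp _ f g

lemma vTensorUnit_desc {v : V} {x y : N} (f : v ⟶ (x ⟶[V] y)) :
    vTensorUnit v x ≫ eHomWhiskerLeft V x (vTensorDesc f) = f := by
  apply vTensorDesc.injective
  rw [← vTensorDesc_comp, vTensorUnit, Equiv.apply_symm_apply, Category.id_comp]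

/-- Functoriality of the tensor `v ⊗ x` in `v`. -/
def vTensorMap {v v' : V} (f : v ⟶ v') (x : N) : vTensor v x ⟶ vTensor v' x :=
  vTensorDesc (f ≫ vTensorUnit v' x)

lemma vTensorMap_desc {v v' : V} (f : v ⟶ v') {x y : N} (g : v' ⟶ (x ⟶[V] y)) :
    vTensorMap f x ≫ vTensorDesc g = vTensorDesc (f ≫ g) := by
  rw [vTensorMap, vTensorDesc_comp, Category.assoc, vTensorUnit_desc]

lemma vTensorMap_id (v : V) (x : N) : vTensorMap (𝟙 v) x = 𝟙 (vTensor v x) := by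
  rw [vTensorMap, Category.id_comp, vTensorUnit, Equiv.apply_symm_apply]

lemma vTensorMap_comp {v v' v'' : V} (f : v ⟶ v') (g : v' ⟶ v'') (x : N) :
    vTensorMap (f ≫ g) x = vTensorMap f x ≫ vTensorMap g x := by
  conv_rhs => rw [vTensorMap.eq_def g, vTensorMap_desc, ← Category.assoc]
  rfl

variable {C : Type w} [EnrichedCategory V C] (G : EnrichedFunctor V C N)

/-- The action `(v ⊗ C(x, y)) ⊗ G(x) ⟶ v ⊗ G(y)` of a `V`-functor `G : C → N`. -/
def functorAct (v : V) (x y : C) : vTensor (v ⊗ (x ⟶[V] y)) (G.obj x) ⟶ vTensor v (G.obj y) :=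
  vTensorDesc ((β_ v (x ⟶[V] y)).hom ≫ (G.map x y ⊗ₘ vTensorUnit v (G.obj y)) ≫
    eComp V (G.obj x) (G.obj y) (vTensor v (G.obj y)))

lemma functorAct_desc (v : V) (x y : C) {z : N} (g : v ⟶ (G.obj y ⟶[V] z)) :
    functorAct G v x y ≫ vTensorDesc g = vTensorDesc ((β_ v (x ⟶[V] y)).hom ≫ (G.map x y ⊗ₘ g) ≫
      eComp V (G.obj x) (G.obj y) z) := by
  unfold functorAct
  rw [vTensorDesc_comp, Category.assoc, Category.assoc, eComp_eHomWhiskerLeft,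
    MonoidalCategory.tensorHom_def, Category.assoc, ← MonoidalCategory.whiskerLeft_comp_assoc,
    vTensorUnit_desc, MonoidalCategory.tensorHom_def, Category.assoc]

lemma functorAct_naturality {v v' : V} (f : v ⟶ v') (x y : C) :
    vTensorMap (f ▷ (x ⟶[V] y)) (G.obj x) ≫ functorAct G v' x y =
      functorAct G v x y ≫ vTensorMap f (G.obj y) := by
  unfold vTensorMap
  rw [functorAct_desc]
  unfold functorAct
  rw [← vTensorMap.eq_def, vTensorMap_desc, BraidedCategory.braiding_naturality_left_assoc,
    MonoidalCategory.tensorHom_def', MonoidalCategory.tensorHom_def',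
    MonoidalCategory.whiskerLeft_comp_assoc, Category.assoc, Category.assoc, Category.assoc]

lemma functorAct_id (v : V) (x : C) :
    vTensorMap ((ρ_ v).inv ≫ v ◁ eId V x) (G.obj x) ≫ functorAct G v x x = 𝟙 _ := by
  have h : (𝟙 (vTensor v (G.obj x))) = vTensorDesc (vTensorUnit v (G.obj x)) := by
    rw [vTensorUnit, Equiv.apply_symm_apply]
  rw [h]
  unfold functorAct
  rw [vTensorMap_desc, Category.assoc, BraidedCategory.braiding_naturality_right_assoc,
    MonoidalCategory.tensorHom_def, Category.assoc, ← comp_whiskerRight_assoc, G.map_id,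
    ← whisker_exchange_assoc]
  simp

lemma braid_aux {a a' b b' v v' p r t : V} (f : a ⟶ a') (g : b ⟶ b') (u : v ⟶ v')
    (k : a' ⊗ b' ⟶ p) (q : b' ⊗ v' ⟶ r) (kk : p ⊗ v' ⟶ t) (qq : a' ⊗ r ⟶ t)
    (h : (α_ a' b' v').hom ≫ a' ◁ q ≫ qq = k ▷ v' ≫ kk) :
    (β_ (v ⊗ b) a).hom ≫ (f ⊗ₘ ((β_ v b).hom ≫ (g ⊗ₘ u) ≫ q)) ≫ qq =
      (α_ v b a).hom ≫ v ◁ (β_ b a).hom ≫ (β_ v (a ⊗ b)).hom ≫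
        (((f ⊗ₘ g) ≫ k) ⊗ₘ u) ≫ kk := by
  have e₁ : (((f ⊗ₘ g) ≫ k) ⊗ₘ u) ≫ kk =
      (α_ a b v).hom ≫ (f ⊗ₘ (g ⊗ₘ u)) ≫ a' ◁ q ≫ qq := by
    rw [← MonoidalCategory.associator_naturality_assoc, h]
    simp only [MonoidalCategory.tensorHom_def, comp_whiskerRight, Category.assoc]
    rw [whisker_exchange_assoc]
  have e₂ : (f ⊗ₘ ((β_ v b).hom ≫ (g ⊗ₘ u) ≫ q)) ≫ qq =
      a ◁ (β_ v b).hom ≫ (f ⊗ₘ (g ⊗ₘ u)) ≫ a' ◁ q ≫ qq := by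
    rw [MonoidalCategory.tensorHom_def, MonoidalCategory.tensorHom_def (X₂ := b ⊗ v)]
    simp only [MonoidalCategory.whiskerLeft_comp, Category.assoc]
    rw [whisker_exchange_assoc]
  rw [e₁, e₂]
  simp [BraidedCategory.braiding_tensor_left_hom, BraidedCategory.braiding_tensor_right_hom]

lemma functorAct_comp (v : V) (x y z : C) :
    functorAct G (v ⊗ (y ⟶[V] z)) x y ≫ functorAct G v y z =
      vTensorMap ((α_ v (y ⟶[V] z) (x ⟶[V] y)).hom ≫ v ◁ homComp V x y z) (G.obj x) ≫
        functorAct G v x z := by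
  rw [functorAct.eq_def G v y z, functorAct_desc]
  unfold functorAct
  rw [vTensorMap_desc, braid_aux _ _ _ _ _ _ _
    (e_assoc' V (G.obj x) (G.obj y) (G.obj z) (vTensor v (G.obj z))), ← G.map_comp x y z]
  unfold homComp
  rw [MonoidalCategory.whiskerLeft_comp, Category.assoc, Category.assoc,
    BraidedCategory.braiding_naturality_right_assoc v (eComp V x y z),
    MonoidalCategory.tensorHom_def, MonoidalCategory.tensorHom_def, comp_whiskerRight]
  simp only [Category.assoc]

lemma bar_id_aux {A B : V} (x : C) (s : A ⟶ B ⊗ (x ⟶[V] x)) (r : B ⟶ A)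
    (h : s ≫ r ▷ (x ⟶[V] x) = (ρ_ A).inv ≫ A ◁ eId V x) :
    vTensorMap s (G.obj x) ≫ functorAct G B x x ≫ vTensorMap r (G.obj x) = 𝟙 _ := by
  rw [← functorAct_naturality, ← reassoc_of% vTensorMap_comp, h, functorAct_id]

lemma bar_comp_aux {A A' A'' B B' D : V} (x y z : C) (s : A ⟶ B ⊗ (x ⟶[V] y)) (r : B ⟶ A')
    (s' : A' ⟶ B' ⊗ (y ⟶[V] z)) (r' : B' ⟶ A'') (s₂ : B ⟶ D ⊗ (y ⟶[V] z)) (r₂ : D ⟶ B')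
    (s₃ : A ⟶ D ⊗ (x ⟶[V] z)) (r₃ : D ⟶ A'') (h : r ≫ s' = s₂ ≫ r₂ ▷ (y ⟶[V] z))
    (h' : s₃ = s ≫ s₂ ▷ (x ⟶[V] y) ≫ (α_ _ _ _).hom ≫ D ◁ homComp V x y z)
    (h'' : r₂ ≫ r' = r₃) :
    (vTensorMap s (G.obj x) ≫ functorAct G B x y ≫ vTensorMap r (G.obj y)) ≫
        vTensorMap s' (G.obj y) ≫ functorAct G B' y z ≫ vTensorMap r' (G.obj z) =
      vTensorMap s₃ (G.obj x) ≫ functorAct G D x z ≫ vTensorMap r₃ (G.obj z) := by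
  rw [Category.assoc, Category.assoc, ← reassoc_of% vTensorMap_comp, h, reassoc_of% vTensorMap_comp,
    reassoc_of% functorAct_naturality, ← vTensorMap_comp, h'', ← reassoc_of% functorAct_naturality,
    reassoc_of% functorAct_comp, ← reassoc_of% vTensorMap_comp, ← reassoc_of% vTensorMap_comp, h']
  simp only [Category.assoc]

lemma presheafAct_naturality {F F' : EnrichedFunctor V Cᵒᵖ V} (τ : VNatTrans V F F') (x y : C) :
    τ.app (op y) ▷ (x ⟶[V] y) ≫ presheafAct F' x y = presheafAct F x y ≫ τ.app (op x) := by
  have h := τ.naturality (op y) (op x)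
  rw [MonoidalClosed.enrichedOrdinaryCategorySelf_eHomWhiskerLeft,
    MonoidalClosed.enrichedOrdinaryCategorySelf_eHomWhiskerRight] at h
  have h' := congrArg MonoidalClosed.uncurry h
  rw [MonoidalClosed.uncurry_natural_right, MonoidalClosed.uncurry_pre_app] at h'
  exact h'.symm

section Bar

variable (F : EnrichedFunctor V Cᵒᵖ V)

/-- For `c = (c₀, …, cₙ)`, the summand
`F(cₙ) ⊗ C(cₙ₋₁, cₙ) ⊗ ⋯ ⊗ C(c₀, c₁) ⊗ G(c₀)` of `Bₙ(F, C, G)`. -/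
def barTerm (n : ℕ) (c : Fin (n + 1) → C) : N :=
  vTensor (barCoeff F n c) (G.obj (c 0))

/-- The action of `φ : [m] → [n]` on the summand of `c = (c₀, …, cₙ)`, with values in the summand of
`c ∘ φ`: the factors `C(cᵢ, cᵢ₊₁)` with `i < φ 0` act on `G`, those with `φ m ≤ i` act on `F`, those
between `φ j` and `φ (j + 1)` are composed, and identities are inserted where `φ j = φ (j + 1)`.
For coface maps this gives the usual face maps, for codegeneracy maps the usual degeneracies. -/
def barTermMap {m n : ℕ} (φ : Fin (m + 1) →o Fin (n + 1)) (c : Fin (n + 1) → C) :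
    barTerm G F n c ⟶ barTerm G F m (fun i => c (φ i)) :=
  vTensorMap (split₀ F n c (φ 0)) (G.obj (c 0)) ≫
    functorAct G (tailCoeff F n c (φ 0)) (c 0) (c (φ 0)) ≫
      vTensorMap (reindex₀ F c m φ) (G.obj (c (φ 0)))

lemma barTermMap_id {n : ℕ} (c : Fin (n + 1) → C) :
    barTermMap G F OrderHom.id c = 𝟙 (barTerm G F n c) :=
  bar_id_aux G (c 0) (split₀ F n c 0) (reindex₀ F c n OrderHom.id) (split₀_reindex₀_id F n c)

lemma barTermMap_comp {l m n : ℕ} (φ : Fin (m + 1) →o Fin (n + 1))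
    (ψ : Fin (l + 1) →o Fin (m + 1)) (c : Fin (n + 1) → C) :
    barTermMap G F φ c ≫ barTermMap G F ψ (fun i => c (φ i)) =
      barTermMap G F (φ.comp ψ) c :=
  bar_comp_aux G (c 0) (c (φ 0)) (c (φ (ψ 0))) (split₀ F n c (φ 0)) (reindex₀ F c m φ)
    (split₀ F m (fun i => c (φ i)) (ψ 0)) (reindex₀ F (fun i => c (φ i)) l ψ)
    (split F n c (φ 0) (φ (ψ 0)) (φ.monotone (Fin.zero_le _))) (reindex F c m φ (ψ 0))
    (split₀ F n c (φ (ψ 0))) (reindex₀ F c l (φ.comp ψ)) (reindex₀_split₀ F c m φ (ψ 0))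
    (split₀_split F n c _ _ _) (reindex₀_comp F c φ l ψ)

variable [HasColimitsOfSize.{w, w} N]

/-- The simplicial bar construction `B_•(F, C, G)`, with
`Bₙ(F, C, G) = ∐_{c₀, …, cₙ} F(cₙ) ⊗ C(cₙ₋₁, cₙ) ⊗ ⋯ ⊗ C(c₀, c₁) ⊗ G(c₀)`. -/
def bar : SimplicialObject N where
  obj Δ := ∐ fun c : Fin (Δ.unop.len + 1) → C => barTerm G F Δ.unop.len c
  map f := Limits.Sigma.desc fun c => barTermMap G F f.unop.toOrderHom c ≫
    Limits.Sigma.ι (fun c => barTerm G F _ c) (fun i => c (f.unop.toOrderHom i))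
  map_id Δ := by
    refine Sigma.hom_ext _ _ fun c => ?_
    rw [Sigma.ι_desc, Category.comp_id]
    refine Eq.trans ?_ (Category.id_comp _)
    exact congrArg (· ≫ _) (barTermMap_id G F c)
  map_comp f g := by
    refine Sigma.hom_ext _ _ fun c => ?_
    rw [Sigma.ι_desc, Sigma.ι_desc_assoc, Category.assoc, Sigma.ι_desc, ← Category.assoc,
      barTermMap_comp]
    rfl

end Bar

section BarMap

variable {F F' : EnrichedFunctor V Cᵒᵖ V} (τ : VNatTrans V F F')

/-- The morphism `τ ⊗ id` on `F(cₙ) ⊗ C(cₙ₋₁, cₙ) ⊗ ⋯ ⊗ C(c₀, c₁)`. -/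
def barCoeffMap : (n : ℕ) → (c : Fin (n + 1) → C) → (barCoeff F n c ⟶ barCoeff F' n c)
  | 0, c => τ.app (op (c 0))
  | n + 1, c => barCoeffMap n (fun i => c i.succ) ▷ (c 0 ⟶[V] c (Fin.succ 0))

/-- The morphism `τ ⊗ id` on `F(cₙ) ⊗ C(cₙ₋₁, cₙ) ⊗ ⋯ ⊗ C(cᵢ, cᵢ₊₁)`. -/
def tailCoeffMap : (n : ℕ) → (c : Fin (n + 1) → C) → (i : Fin (n + 1)) →
    (tailCoeff F n c i ⟶ tailCoeff F' n c i)
  | 0, c, _ => barCoeffMap τ 0 c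
  | n + 1, c, i =>
      Fin.cases (motive := fun i => tailCoeff F (n + 1) c i ⟶ tailCoeff F' (n + 1) c i)
        (barCoeffMap τ (n + 1) c) (fun i => tailCoeffMap n (fun k => c k.succ) i) i

lemma unit_naturality {A B : V} (x : C) (f : A ⟶ B) :
    f ≫ ((ρ_ B).inv ≫ B ◁ eId V x) = ((ρ_ A).inv ≫ A ◁ eId V x) ≫ f ▷ (x ⟶[V] x) := by
  rw [Category.assoc, whisker_exchange, ← rightUnitor_inv_naturality_assoc]

lemma split₀_naturality (n : ℕ) (c : Fin (n + 1) → C) (j : Fin (n + 1)) :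
    barCoeffMap τ n c ≫ split₀ F' n c j =
      split₀ F n c j ≫ tailCoeffMap τ n c j ▷ (c 0 ⟶[V] c j) := by
  induction n with
  | zero =>
    cases j using Fin.cases with
    | zero => exact unit_naturality _ _
    | succ i => exact i.elim0
  | succ n ih =>
    cases j using Fin.cases with
    | zero => exact unit_naturality _ _
    | succ j =>
      have ih' := ih (fun k => c k.succ) j
      change barCoeffMap τ n (fun k => c k.succ) ▷ (c 0 ⟶[V] c (Fin.succ 0)) ≫
        split₀ F' n (fun k => c k.succ) j ▷ (c 0 ⟶[V] c (Fin.succ 0)) ≫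
          (α_ _ _ _).hom ≫ tailCoeff F' n (fun k => c k.succ) j ◁
            homComp V (c 0) (c (Fin.succ 0)) (c j.succ) =
        (split₀ F n (fun k => c k.succ) j ▷ (c 0 ⟶[V] c (Fin.succ 0)) ≫
          (α_ _ _ _).hom ≫ tailCoeff F n (fun k => c k.succ) j ◁
            homComp V (c 0) (c (Fin.succ 0)) (c j.succ)) ≫
          tailCoeffMap τ n (fun k => c k.succ) j ▷ (c 0 ⟶[V] c j.succ)
      rw [← comp_whiskerRight_assoc, ih']
      simp only [comp_whiskerRight, Category.assoc]
      rw [whisker_exchange, associator_naturality_left_assoc]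

lemma split_naturality (n : ℕ) (c : Fin (n + 1) → C) (i j : Fin (n + 1)) (h : i ≤ j) :
    tailCoeffMap τ n c i ≫ split F' n c i j h =
      split F n c i j h ≫ tailCoeffMap τ n c j ▷ (c i ⟶[V] c j) := by
  induction n with
  | zero =>
    cases i using Fin.cases with
    | zero => exact split₀_naturality τ 0 c j
    | succ i => exact i.elim0
  | succ n ih =>
    cases i using Fin.cases with
    | zero => exact split₀_naturality τ (n + 1) c j
    | succ i =>
      cases j using Fin.cases with
      | zero => exact absurd h (Fin.not_le.2 i.succ_pos)
      | succ j => exact ih (fun k => c k.succ) i j _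

lemma collapse₀_naturality (n : ℕ) (c : Fin (n + 1) → C) :
    barCoeffMap τ n c ≫ collapse₀ F' n c = collapse₀ F n c ≫ τ.app (op (c 0)) := by
  induction n with
  | zero => exact (Category.comp_id _).trans (Category.id_comp _).symm
  | succ n ih =>
    have ih' := ih (fun k => c k.succ)
    change barCoeffMap τ n (fun k => c k.succ) ▷ (c 0 ⟶[V] c (Fin.succ 0)) ≫
      collapse₀ F' n (fun k => c k.succ) ▷ (c 0 ⟶[V] c (Fin.succ 0)) ≫
        presheafAct F' (c 0) (c (Fin.succ 0)) =
      (collapse₀ F n (fun k => c k.succ) ▷ (c 0 ⟶[V] c (Fin.succ 0)) ≫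
        presheafAct F (c 0) (c (Fin.succ 0))) ≫ τ.app (op (c 0))
    rw [← comp_whiskerRight_assoc, ih', comp_whiskerRight_assoc, presheafAct_naturality,
      Category.assoc]

lemma collapse_naturality (n : ℕ) (c : Fin (n + 1) → C) (i : Fin (n + 1)) :
    tailCoeffMap τ n c i ≫ collapse F' n c i = collapse F n c i ≫ τ.app (op (c i)) := by
  induction n with
  | zero =>
    cases i using Fin.cases with
    | zero => exact collapse₀_naturality τ 0 c
    | succ i => exact i.elim0
  | succ n ih =>
    cases i using Fin.cases with
    | zero => exact collapse₀_naturality τ (n + 1) c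
    | succ i => exact ih (fun k => c k.succ) i

lemma reindex₀_naturality {n : ℕ} (c : Fin (n + 1) → C) (m : ℕ)
    (φ : Fin (m + 1) →o Fin (n + 1)) :
    tailCoeffMap τ n c (φ 0) ≫ reindex₀ F' c m φ =
      reindex₀ F c m φ ≫ barCoeffMap τ m (fun i => c (φ i)) := by
  induction m with
  | zero => exact collapse_naturality τ n c (φ 0)
  | succ m ih =>
    have ih' := ih (ordTail φ)
    refine (reindex_comp_aux _ _ _ _ _ _ (split_naturality τ n c (φ 0) (φ (Fin.succ 0))
      (φ.monotone (Fin.zero_le _))) ih').trans ?_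
    exact (congrArg (_ ≫ ·) (comp_whiskerRight _ _ _)).trans (Category.assoc _ _ _).symm

lemma bar_nat_aux {A A' B B' D D' : V} (x y : C) (a : A ⟶ A') (b : B ⟶ B') (d : D ⟶ D')
    (s : A ⟶ B ⊗ (x ⟶[V] y)) (s' : A' ⟶ B' ⊗ (x ⟶[V] y)) (r : B ⟶ D) (r' : B' ⟶ D')
    (h : a ≫ s' = s ≫ b ▷ (x ⟶[V] y)) (h' : b ≫ r' = r ≫ d) :
    vTensorMap a (G.obj x) ≫ vTensorMap s' (G.obj x) ≫ functorAct G B' x y ≫ vTensorMap r' (G.obj y) =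
      (vTensorMap s (G.obj x) ≫ functorAct G B x y ≫ vTensorMap r (G.obj y)) ≫
        vTensorMap d (G.obj y) := by
  rw [← reassoc_of% vTensorMap_comp, h, reassoc_of% vTensorMap_comp, reassoc_of% functorAct_naturality,
    ← vTensorMap_comp, h', vTensorMap_comp, Category.assoc, Category.assoc]

/-- The morphism `τ ⊗ id` on `F(cₙ) ⊗ C(cₙ₋₁, cₙ) ⊗ ⋯ ⊗ C(c₀, c₁) ⊗ G(c₀)`. -/
def barTermTrans (n : ℕ) (c : Fin (n + 1) → C) : barTerm G F n c ⟶ barTerm G F' n c :=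
  vTensorMap (barCoeffMap τ n c) (G.obj (c 0))

lemma barTermMap_naturality {m n : ℕ} (φ : Fin (m + 1) →o Fin (n + 1)) (c : Fin (n + 1) → C) :
    barTermTrans G τ n c ≫ barTermMap G F' φ c =
      barTermMap G F φ c ≫ barTermTrans G τ m (fun i => c (φ i)) :=
  bar_nat_aux G (c 0) (c (φ 0)) (barCoeffMap τ n c) (tailCoeffMap τ n c (φ 0))
    (barCoeffMap τ m (fun i => c (φ i))) (split₀ F n c (φ 0)) (split₀ F' n c (φ 0))
    (reindex₀ F c m φ) (reindex₀ F' c m φ) (split₀_naturality τ n c (φ 0))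
    (reindex₀_naturality τ c m φ)

variable [HasColimitsOfSize.{w, w} N]

/-- The morphism `B_•(F, C, G) ⟶ B_•(F', C, G)` induced by `τ : F ⟶ F'`. -/
def barMap : bar G F ⟶ bar G F' where
  app Δ := Limits.Sigma.map fun c => barTermTrans G τ Δ.unop.len c
  naturality Δ Δ' f := by
    refine Sigma.hom_ext _ _ fun c => ?_
    dsimp only [bar]
    rw [Sigma.ι_desc_assoc, Category.assoc, Sigma.ι_map, Sigma.ι_map_assoc,
      Sigma.ι_desc, ← Category.assoc, ← Category.assoc]
    exact congrArg (· ≫ _) (barTermMap_naturality G τ f.unop.toOrderHom c).symm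

end BarMap
end Tensors
section ModelCategories

variable (V : Type u₁) [Category.{v₁} V] [MonoidalCategory V] [ModelCategory V]

/-- The axioms relating the (closed symmetric) monoidal structure and the model structure in a
symmetric monoidal model category with cofibrant unit. -/
class IsMonoidalModelCategory : Prop where
  cofibration_pushoutProduct {v v' w w' : V} (i : v ⟶ v') (j : w ⟶ w')
    [Cofibration i] [Cofibration j] :
    Cofibration ((Arrow.pushoutProduct.obj (Arrow.mk i)).obj (Arrow.mk j)).hom
  weakEquivalence_pushoutProduct {v v' w w' : V} (i : v ⟶ v') (j : w ⟶ w')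
    [Cofibration i] [Cofibration j] (h : WeakEquivalence i ∨ WeakEquivalence j) :
    WeakEquivalence ((Arrow.pushoutProduct.obj (Arrow.mk i)).obj (Arrow.mk j)).hom
  isCofibrant_unit : IsCofibrant (𝟙_ V)

/-- The pullback-power map `N(B, X) ⟶ N(B, Y) ×_{N(A, Y)} N(A, X)` of `i : A ⟶ B` and
`p : X ⟶ Y`. -/
def pullbackPower {N : Type u₂} [Category.{v₂} N] [EnrichedOrdinaryCategory V N]
    {A B X Y : N} (i : A ⟶ B) (p : X ⟶ Y) :
    (B ⟶[V] X) ⟶ pullback (eHomWhiskerRight V i Y) (eHomWhiskerLeft V A p) :=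
  pullback.lift (eHomWhiskerLeft V B p) (eHomWhiskerRight V i X) (eHom_whisker_exchange V i p)

/-- The axiom relating the enrichment and the model structure in a `V`-model category. -/
class IsEnrichedModelCategory (N : Type u₂) [Category.{v₂} N] [EnrichedOrdinaryCategory V N]
    [ModelCategory N] : Prop where
  fibration_pullbackPower {A B X Y : N} (i : A ⟶ B) (p : X ⟶ Y) [Cofibration i] [Fibration p] :
    Fibration (pullbackPower V i p)
  weakEquivalence_pullbackPower {A B X Y : N} (i : A ⟶ B) (p : X ⟶ Y)
    [Cofibration i] [Fibration p] (h : WeakEquivalence i ∨ WeakEquivalence p) :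
    WeakEquivalence (pullbackPower V i p)

end ModelCategories

section Reedy

/-- The `n`-th latching category of `Δᵒᵖ`: surjections `[n] → [k]` in `Δ` with `k < n`, regarded as
objects of the category of morphisms of `Δᵒᵖ` with target `[n]`. -/
abbrev LatchingIndex (n : ℕ) : Type :=
  ObjectProperty.FullSubcategory fun f : Over (op (SimplexCategory.mk n)) =>
    Epi f.hom.unop ∧ f.left.unop.len < n

instance (n : ℕ) : Finite (LatchingIndex n) := by
  refine Finite.of_surjective
    (fun p : (Σ k : Fin n, {q : SimplexCategory.mk n ⟶ SimplexCategory.mk k // Epi q}) =>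
      (⟨Over.mk p.2.1.op, p.2.2, p.1.2⟩ : LatchingIndex n)) ?_
  rintro ⟨f, hf, hn⟩
  exact ⟨⟨⟨f.left.unop.len, hn⟩, ⟨f.hom.unop, hf⟩⟩, rfl⟩

instance (n : ℕ) (f g : LatchingIndex n) : Finite (f ⟶ g) := by
  refine Finite.of_injective (fun u => u.hom.left.unop) fun u v h => ?_
  ext
  exact Quiver.Hom.unop_inj h

instance (n : ℕ) : FinCategory (LatchingIndex n) where
  fintypeObj := Fintype.ofFinite _
  fintypeHom _ _ := Fintype.ofFinite _

variable {N : Type u₂} [Category.{v₂} N]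

/-- The diagram of the `X_k` indexed by the `n`-th latching category. -/
def latchingDiagram (X : SimplicialObject N) (n : ℕ) : LatchingIndex n ⥤ N where
  obj f := X.obj f.obj.left
  map u := X.map u.hom.left
  map_id _ := X.map_id _
  map_comp _ _ := X.map_comp _ _

/-- The cocone on the latching diagram with point `X_n`, given by the degeneracies. -/
def latchingCocone (X : SimplicialObject N) (n : ℕ) : Cocone (latchingDiagram X n) where
  pt := X.obj (op (SimplexCategory.mk n))
  ι :=
    { app := fun f => X.map f.obj.hom
      naturality := fun _ _ u => by
        refine Eq.trans ?_ (Category.comp_id _).symm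
        exact (X.map_comp _ _).symm.trans (congrArg X.map (Over.w u.hom)) }

/-- The map of latching diagrams induced by `f : X ⟶ Y`. -/
def latchingDiagramMap {X Y : SimplicialObject N} (f : X ⟶ Y) (n : ℕ) :
    latchingDiagram X n ⟶ latchingDiagram Y n where
  app j := f.app j.obj.left
  naturality _ _ u := f.naturality u.hom.left

variable [HasFiniteColimits N]

/-- The latching object `L_n X`. -/
def latchingObj (X : SimplicialObject N) (n : ℕ) : N :=
  colimit (latchingDiagram X n)

/-- The latching map `L_n X ⟶ X_n`. -/
def latchingMap (X : SimplicialObject N) (n : ℕ) :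
    latchingObj X n ⟶ X.obj (op (SimplexCategory.mk n)) :=
  colimit.desc (latchingDiagram X n) (latchingCocone X n)

/-- The morphism `L_n X ⟶ L_n Y` induced by `f : X ⟶ Y`. -/
def latchingObjMap {X Y : SimplicialObject N} (f : X ⟶ Y) (n : ℕ) :
    latchingObj X n ⟶ latchingObj Y n :=
  colimMap (latchingDiagramMap f n)

lemma latchingObjMap_latchingMap {X Y : SimplicialObject N} (f : X ⟶ Y) (n : ℕ) :
    latchingMap X n ≫ f.app (op (SimplexCategory.mk n)) =
      latchingObjMap f n ≫ latchingMap Y n := by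
  refine colimit.hom_ext (F := latchingDiagram X n) fun j => ?_
  have h1 := colimit.ι_desc_assoc (latchingCocone X n) j (f.app (op (SimplexCategory.mk n)))
  have h2 := ι_colimMap_assoc (latchingDiagramMap f n) j (latchingMap Y n)
  have h3 := congrArg (fun t => (latchingDiagramMap f n).app j ≫ t)
    (colimit.ι_desc (latchingCocone Y n) j)
  exact h1.trans ((f.naturality j.obj.hom).trans (h3.symm.trans h2.symm))

/-- The relative latching map `X_n ∪_{L_n X} L_n Y ⟶ Y_n` of `f : X ⟶ Y`. -/
def relativeLatchingMap {X Y : SimplicialObject N} (f : X ⟶ Y) (n : ℕ) :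
    pushout (latchingMap X n) (latchingObjMap f n) ⟶ Y.obj (op (SimplexCategory.mk n)) :=
  pushout.desc (f.app (op (SimplexCategory.mk n))) (latchingMap Y n)
    (latchingObjMap_latchingMap f n)

/-- A morphism of simplicial objects is a Reedy cofibration if all its relative latching maps are
cofibrations. -/
def IsReedyCofibration [CategoryWithCofibrations N] {X Y : SimplicialObject N} (f : X ⟶ Y) :
    Prop :=
  ∀ n : ℕ, Cofibration (relativeLatchingMap f n)

end Reedy

end

end EnrichedBar

/-! Cofibrations of `N` are the maps with the left lifting property against all trivial fibrations
`p : X ⟶ Y`. Lifting the relative latching map against `p` means finding `Bₙ(F', C, G) ⟶ X` with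
prescribed restriction to `Bₙ(F, C, G)`, prescribed composite with `p` and prescribed values on
degeneracies. Since `Bₙ` is a coproduct of tensors, such a map is a family of maps `F'(cₙ) ⊗ ⋯ ⊗
C(c₀, c₁) ⟶ N(G c₀, X)`, one for each sequence `c` (`barHomEquiv`). As `G c₀` is cofibrant, `N(G c₀,
X) ⟶ N(G c₀, Y)` lifts against the cofibrations of `V` (`rlp_eHomWhiskerLeft`), and the problem
becomes one in `V`.

That problem is solved for arbitrary targets `P y ⟶ Q y` in `exists_barCoeff_lift`, by induction on
`n`. Fix `c₀ = z` and transpose the factor `C(z, y)`, where `y = c₁`, so that `P z` becomes `[C(z,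
y), P z]`. The degeneracy repeating the first vertex concerns only `y = z` and prescribes the
restriction along `𝟙 ⟶ C(z, z)`. All other degeneracies leave the factor alone and become
degeneracies of the shorter sequence. The new problem is thus against `[C(z, y), P z] ⟶ R`, with `R
= [C(z, z), Q z] ×_{Q z} P z` if `y = z` and `R = [C(z, y), Q z]` otherwise. By the pushout-product
axiom for `𝟙 ⟶ C(z, z)` or `⊥ ⟶ C(z, y)`, this map again lifts against cofibrations
(`exists_relative_ihom`).

Latching objects enter only through maps out of them: these are determined on elementary
degeneracies (`latchingObj_hom_ext`) and satisfy the relations `CodegenSq`. Elementary surjections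
form an inductive type because its recursion matches that of `barCoeff`. -/

namespace EnrichedBar

noncomputable section

/-! ### Transposition of the right tensor factor and evaluation of internal homs. -/

section ClosedMonoidal

variable {V : Type u₁} [Category.{v₁} V] [MonoidalCategory V] [SymmetricCategory V]
  [MonoidalClosed V]

/-- Currying of the right-hand factor. -/
def curryRight {A K P : V} : (A ⊗ K ⟶ P) ≃ (A ⟶ (ihom K).obj P) :=
  ((β_ A K).homFromEquiv).trans ((ihom.adjunction K).homEquiv A P)

lemma curryRight_eq {A K P : V} (g : A ⊗ K ⟶ P) :
    curryRight g = MonoidalClosed.curry ((β_ A K).inv ≫ g) := rfl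

lemma curryRight_comp {A K P Q : V} (g : A ⊗ K ⟶ P) (p : P ⟶ Q) :
    curryRight (g ≫ p) = curryRight g ≫ (ihom K).map p := by
  rw [curryRight_eq, curryRight_eq, ← MonoidalClosed.curry_natural_right, Category.assoc]

lemma curryRight_whiskerRight_comp {A B K P : V} (f : A ⟶ B) (g : B ⊗ K ⟶ P) :
    curryRight (f ▷ K ≫ g) = f ≫ curryRight g := by
  rw [curryRight_eq, curryRight_eq, ← MonoidalClosed.curry_natural_left]
  simp

lemma curryRight_symm_comp {A K P Q : V} (g : A ⟶ (ihom K).obj P) (p : P ⟶ Q) :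
    curryRight.symm (g ≫ (ihom K).map p) = curryRight.symm g ≫ p := by
  rw [Equiv.symm_apply_eq, curryRight_comp, Equiv.apply_symm_apply]

lemma whiskerRight_comp_curryRight_symm {A B K P : V} (f : A ⟶ B) (g : B ⟶ (ihom K).obj P) :
    f ▷ K ≫ curryRight.symm g = curryRight.symm (f ≫ g) := by
  rw [Equiv.eq_symm_apply, curryRight_whiskerRight_comp, Equiv.apply_symm_apply]

/-- Evaluation of the internal hom at an element. -/
def evalAt {K : V} (u : 𝟙_ V ⟶ K) (P : V) : (ihom K).obj P ⟶ P :=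
  (ρ_ _).inv ≫ (ihom K).obj P ◁ u ≫ curryRight.symm (𝟙 _)

lemma comp_evalAt {A K P : V} (u : 𝟙_ V ⟶ K) (g : A ⟶ (ihom K).obj P) :
    g ≫ evalAt u P = (ρ_ A).inv ≫ A ◁ u ≫ curryRight.symm g := by
  unfold evalAt
  rw [rightUnitor_inv_naturality_assoc, ← whisker_exchange_assoc, whiskerRight_comp_curryRight_symm,
    Category.comp_id]

lemma evalAt_naturality {K P Q : V} (u : 𝟙_ V ⟶ K) (p : P ⟶ Q) :
    (ihom K).map p ≫ evalAt u Q = evalAt u P ≫ p := by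
  rw [comp_evalAt]
  unfold evalAt
  simp only [Category.assoc]
  rw [← curryRight_symm_comp, Category.id_comp]

/-- An equation between maps into the object `R` of `exists_relative_ihom` is checked on its
components `a` and `b`; this is the `a` component, and `curryRight_comp_evalAt` is the `b`
component. -/
lemma curryRight_comp_comp {A B K P Q R : V} {p : P ⟶ Q} {f : A ⟶ B} {g : A ⊗ K ⟶ P}
    {h : B ⊗ K ⟶ Q} {r : (ihom K).obj P ⟶ R} {a : R ⟶ (ihom K).obj Q} {h' : B ⟶ R}
    (hr : r ≫ a = (ihom K).map p) (hh' : h' ≫ a = curryRight h) (w : g ≫ p = f ▷ K ≫ h) :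
    (curryRight g ≫ r) ≫ a = (f ≫ h') ≫ a := by
  rw [Category.assoc, Category.assoc, hr, hh', ← curryRight_comp, w, curryRight_whiskerRight_comp]

lemma curryRight_comp_evalAt {A B K P R : V} {u : 𝟙_ V ⟶ K} {f : A ⟶ B} {g : A ⊗ K ⟶ P}
    {r : (ihom K).obj P ⟶ R} {b : R ⟶ P} {h' : B ⟶ R} {t : B ⟶ P} (hr : r ≫ b = evalAt u P)
    (hh' : h' ≫ b = t) (w : ((ρ_ A).inv ≫ A ◁ u) ≫ g = f ≫ t) :
    (curryRight g ≫ r) ≫ b = (f ≫ h') ≫ b := by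
  rw [Category.assoc, Category.assoc, hr, hh', ← w, comp_evalAt, Equiv.symm_apply_apply,
    Category.assoc]

lemma comp_curryRight_eq {A B D K P : V} {f : A ⟶ B} {f' : A ⟶ D} {g : B ⊗ K ⟶ P}
    {g' : D ⊗ K ⟶ P} (w : f ▷ K ≫ g = f' ▷ K ≫ g') : f ≫ curryRight g = f' ≫ curryRight g' := by
  rw [← curryRight_whiskerRight_comp, w, curryRight_whiskerRight_comp]

lemma whiskerRight_comp_curryRight_symm_eq {A B K P : V} {f : A ⟶ B} {l : B ⟶ (ihom K).obj P}
    {g : A ⊗ K ⟶ P} (w : f ≫ l = curryRight g) : f ▷ K ≫ curryRight.symm l = g := by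
  rw [whiskerRight_comp_curryRight_symm, w, Equiv.symm_apply_apply]

/-- Together with `unit_comp_curryRight_symm_eq`, this reads off what a lift `l` of `h'` through `r`
means before transposition: the `a` component controls the composite with `p`, the `b` component the
restriction along the unit. -/
lemma curryRight_symm_comp_eq {A K P Q R : V} {p : P ⟶ Q} {l : A ⟶ (ihom K).obj P}
    {r : (ihom K).obj P ⟶ R} {a : R ⟶ (ihom K).obj Q} {h' : A ⟶ R} {h : A ⊗ K ⟶ Q}
    (hr : r ≫ a = (ihom K).map p) (hl : l ≫ r = h') (hh' : h' ≫ a = curryRight h) :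
    curryRight.symm l ≫ p = h := by
  rw [← curryRight_symm_comp, ← hr, reassoc_of% hl, hh', Equiv.symm_apply_apply]

lemma unit_comp_curryRight_symm_eq {A K P R : V} {u : 𝟙_ V ⟶ K} {l : A ⟶ (ihom K).obj P}
    {r : (ihom K).obj P ⟶ R} {b : R ⟶ P} {h' : A ⟶ R} {t : A ⟶ P}
    (hr : r ≫ b = evalAt u P) (hl : l ≫ r = h') (hh' : h' ≫ b = t) :
    ((ρ_ A).inv ≫ A ◁ u) ≫ curryRight.symm l = t := by
  rw [Category.assoc, ← comp_evalAt, ← hr, reassoc_of% hl, hh']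

lemma unit_comp_eq {A K P Q : V} {u : 𝟙_ V ⟶ K} {h : A ⊗ K ⟶ Q} {p : P ⟶ Q} {x : A ⟶ P}
    (w : x ≫ p = ((ρ_ A).inv ≫ A ◁ u) ≫ h) : curryRight h ≫ evalAt u Q = x ≫ p := by
  rw [comp_evalAt, Equiv.symm_apply_apply, w, Category.assoc]

end ClosedMonoidal

section Unit

variable {V : Type u₁} [Category.{v₁} V] [MonoidalCategory V]
  {C : Type w} [EnrichedCategory V C]

variable (V) in
/-- The unit `𝟙 ⟶ C(x, y)` for `x = y`. -/
def eqUnit {x y : C} (h : x = y) : 𝟙_ V ⟶ (x ⟶[V] y) :=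
  eId V x ≫ eqToHom (by rw [h])

lemma eqUnit_rfl (x : C) : eqUnit V (rfl : x = x) = eId V x := by
  simp [eqUnit]

end Unit

/-! ### The pushout-product axiom as a lifting property of internal homs. -/

section Lifting

variable {V : Type u₁} [Category.{v₁} V] [MonoidalCategory V] [ModelCategory V]
  [IsMonoidalModelCategory V]

/-- The maps `a` and `b` glue to a map out of the pushout, and the pushout-product of `j` and `k`,
being a cofibration, lifts against `p`. -/
lemma exists_lift_tensor {A B I K P Q : V} (j : A ⟶ B) (k : I ⟶ K) [Cofibration j]
    [Cofibration k] {p : P ⟶ Q} (hp : (cofibrations V).rlp p) (a : A ⊗ K ⟶ P) (b : B ⊗ I ⟶ P)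
    (q : B ⊗ K ⟶ Q) (hab : A ◁ k ≫ a = j ▷ I ≫ b) (ha : a ≫ p = j ▷ K ≫ q)
    (hb : b ≫ p = B ◁ k ≫ q) :
    ∃ l : B ⊗ K ⟶ P, j ▷ K ≫ l = a ∧ B ◁ k ≫ l = b ∧ l ≫ p = q := by
  let sq := Functor.PushoutObjObj.ofHasPushout (curriedTensor V) j k
  have hj : Cofibration sq.ι := IsMonoidalModelCategory.cofibration_pushoutProduct j k
  have hl : sq.inl ≫ sq.ι = B ◁ k := sq.inl_ι
  have hr : sq.inr ≫ sq.ι = j ▷ K := sq.inr_ι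
  let t : sq.pt ⟶ P := sq.isPushout.desc b a hab.symm
  have htl : sq.inl ≫ t = b := sq.isPushout.inl_desc _ _ _
  have htr : sq.inr ≫ t = a := sq.isPushout.inr_desc _ _ _
  have w : t ≫ p = sq.ι ≫ q := by
    refine sq.hom_ext ?_ ?_
    · rw [reassoc_of% htl, reassoc_of% hl, hb]
    · rw [reassoc_of% htr, reassoc_of% hr, ha]
  have := hp sq.ι (mem_cofibrations sq.ι)
  let s : CommSq t sq.ι p q := ⟨w⟩
  refine ⟨s.lift, ?_, ?_, s.fac_right⟩
  · rw [← hr, Category.assoc, s.fac_left, htr]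
  · rw [← hl, Category.assoc, s.fac_left, htl]

variable [SymmetricCategory V] [MonoidalClosed V]

/-- This is `exists_lift_tensor` for `⊥ ⟶ K`. Tensoring with a fixed object is a left adjoint, so `B
⊗ ⊥` is initial and the condition on it is empty. -/
lemma rlp_ihom_map (K : V) [IsCofibrant K] {P Q : V} {p : P ⟶ Q}
    (hp : (cofibrations V).rlp p) : (cofibrations V).rlp ((ihom K).map p) := by
  intro A B j hj
  refine ⟨fun {f g} sq => ?_⟩
  have : Cofibration j := ⟨hj⟩
  have hi (A : V) : IsInitial (A ⊗ (⊥_ V)) :=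
    IsInitial.isInitialObj (tensorLeft A) _ initialIsInitial
  obtain ⟨l, h₁, -, h₂⟩ := exists_lift_tensor j (initial.to K) hp (curryRight.symm f)
    ((hi B).to P) (curryRight.symm g) ((hi A).hom_ext _ _)
    (by rw [← curryRight_symm_comp, sq.w, whiskerRight_comp_curryRight_symm])
    ((hi B).hom_ext _ _)
  refine ⟨⟨⟨curryRight l, ?_, ?_⟩⟩⟩
  · rw [← curryRight_whiskerRight_comp, h₁, Equiv.apply_symm_apply]
  · rw [← curryRight_comp, h₂, Equiv.apply_symm_apply]

/-- The comparison of an internal hom with a pullback, restricting along `u : 𝟙 ⟶ K`. -/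
def ihomComparison {K : V} (u : 𝟙_ V ⟶ K) {P Q : V} (p : P ⟶ Q) :
    (ihom K).obj P ⟶ pullback (evalAt u Q) p :=
  pullback.lift ((ihom K).map p) (evalAt u P) (evalAt_naturality u p)

/-- This is `exists_lift_tensor` for `u`. Under `B ⊗ 𝟙 ≅ B`, the prescribed map on `B ⊗ 𝟙` is the
second component of the map into the pullback. -/
lemma rlp_ihomComparison {K : V} (u : 𝟙_ V ⟶ K) [Cofibration u] {P Q : V} {p : P ⟶ Q}
    (hp : (cofibrations V).rlp p) : (cofibrations V).rlp (ihomComparison u p) := by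
  intro A B j hj
  refine ⟨fun {f g} sq => ?_⟩
  have : Cofibration j := ⟨hj⟩
  have w₁ : f ≫ (ihom K).map p = j ≫ g ≫ pullback.fst _ _ := by
    rw [← sq.w_assoc, ihomComparison, pullback.lift_fst]
  have w₂ : f ≫ evalAt u P = j ≫ g ≫ pullback.snd _ _ := by
    rw [← sq.w_assoc, ihomComparison, pullback.lift_snd]
  have w₃ : (g ≫ pullback.fst _ _) ≫ evalAt u Q = (g ≫ pullback.snd _ _) ≫ p := by
    rw [Category.assoc, Category.assoc, pullback.condition]
  rw [comp_evalAt] at w₂ w₃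
  obtain ⟨l, h₁, h₂, h₃⟩ := exists_lift_tensor j u hp (curryRight.symm f)
    ((ρ_ B).hom ≫ g ≫ pullback.snd _ _) (curryRight.symm (g ≫ pullback.fst _ _))
    (by rw [rightUnitor_naturality_assoc, ← w₂, Iso.hom_inv_id_assoc])
    (by rw [← curryRight_symm_comp, w₁, whiskerRight_comp_curryRight_symm])
    (by rw [Category.assoc, ← w₃, Iso.hom_inv_id_assoc])
  refine ⟨⟨⟨curryRight l, ?_, ?_⟩⟩⟩
  · rw [← curryRight_whiskerRight_comp, h₁, Equiv.apply_symm_apply]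
  · refine pullback.hom_ext ?_ ?_
    · rw [Category.assoc, ihomComparison, pullback.lift_fst, ← curryRight_comp, h₃,
        Equiv.apply_symm_apply]
    · rw [Category.assoc, ihomComparison, pullback.lift_snd, comp_evalAt, Equiv.symm_apply_apply,
        h₂, Iso.inv_hom_id_assoc]

variable {C : Type w} [EnrichedCategory V C]

/-- The map `[C(x, y), P] ⟶ [C(x, y), Q] ×_{[I, Q]} [I, P]`, where `I` is the unit if `x = y` and
initial otherwise. -/
lemma exists_relative_ihom (hHom : ∀ c d : C, IsCofibrant (c ⟶[V] d))
    (hUnit : ∀ c : C, Cofibration (eId V c)) (x y : C) {P Q : V} {p : P ⟶ Q}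
    (hp : (cofibrations V).rlp p) :
    ∃ (R : V) (r : (ihom (x ⟶[V] y)).obj P ⟶ R) (a : R ⟶ (ihom (x ⟶[V] y)).obj Q)
      (b : x = y → (R ⟶ P)), (cofibrations V).rlp r ∧ r ≫ a = (ihom (x ⟶[V] y)).map p ∧
      (∀ h, r ≫ b h = evalAt (eqUnit V h) P) ∧
      (∀ (T : V) (f g : T ⟶ R), f ≫ a = g ≫ a → (∀ h, f ≫ b h = g ≫ b h) → f = g) ∧
      ∀ (T : V) (t : T ⟶ (ihom (x ⟶[V] y)).obj Q) (t' : x = y → (T ⟶ P)),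
        (∀ h, t ≫ evalAt (eqUnit V h) Q = t' h ≫ p) →
          ∃ f : T ⟶ R, f ≫ a = t ∧ ∀ h, f ≫ b h = t' h := by
  have := hHom x y
  -- Only for `x = y` can a degeneracy constrain the factor `C(x, y)`. Indexing `b` by a proof of `x
  -- = y` makes the second component void in the other case, where `R` is just `[C(x, y), Q]`.
  by_cases hxy : x = y
  · subst hxy
    have := hUnit x
    refine ⟨_, ihomComparison (eId V x) p, pullback.fst _ _, fun _ => pullback.snd _ _,
      rlp_ihomComparison _ hp, pullback.lift_fst _ _ _, fun _ => ?_,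
      fun T f g h h' => pullback.hom_ext h (h' rfl), fun T t t' h => ?_⟩
    · rw [eqUnit_rfl]
      exact pullback.lift_snd _ _ _
    · have h' := h rfl
      rw [eqUnit_rfl] at h'
      exact ⟨pullback.lift t (t' rfl) h', pullback.lift_fst _ _ _,
        fun _ => pullback.lift_snd _ _ _⟩
  · exact ⟨_, (ihom _).map p, 𝟙 _, fun h => absurd h hxy, rlp_ihom_map _ hp, Category.comp_id _,
      fun h => absurd h hxy, fun T f g h _ => by simpa using h,
      fun T t t' _ => ⟨t, Category.comp_id _, fun h => absurd h hxy⟩⟩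

end Lifting

/-! ### Elementary degeneracies, their relations and their action on coefficients. -/

/-- The elementary surjections `[n] → [m]` with `n = m + 1`: `zero m` identifies `0` and `1`, and
`s.succ` identifies `i + 1` and `i + 2` if `s` identifies `i` and `i + 1`. -/
inductive Codegen : ℕ → ℕ → Type
  | zero (m : ℕ) : Codegen (m + 1) m
  | succ {n m : ℕ} (s : Codegen n m) : Codegen (n + 1) (m + 1)

/-- The relations `σᵢ σⱼ₊₁ = σⱼ σᵢ` for `i ≤ j` between elementary surjections:
`CodegenSq a b a' b'` expresses that `a` followed by `b` agrees with `a'` followed by `b'`. -/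
inductive CodegenSq : {n m m' k : ℕ} → Codegen n m → Codegen m k → Codegen n m' →
    Codegen m' k → Prop
  | zero {m k : ℕ} (b : Codegen m k) : CodegenSq (.zero m) b b.succ (.zero k)
  | succ {n m m' k : ℕ} {a : Codegen n m} {b : Codegen m k} {a' : Codegen n m'}
      {b' : Codegen m' k} (h : CodegenSq a b a' b') : CodegenSq a.succ b.succ a'.succ b'.succ

namespace Codegen

section Pull

variable {C : Type w}

/-- The entries of `s.pull d` after the first one. -/
def pullTail : {n m : ℕ} → Codegen n m → (Fin (m + 1) → C) → (Fin n → C)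
  | _, _, .zero _, d => d
  | _, _, .succ s, d => Fin.cons (d (Fin.succ 0)) (s.pullTail fun k => d k.succ)

/-- Precomposition of a sequence with an elementary surjection. -/
def pull {n m : ℕ} (s : Codegen n m) (d : Fin (m + 1) → C) : Fin (n + 1) → C :=
  Fin.cons (d 0) (s.pullTail d)

end Pull

section Map

variable {V : Type u₁} [Category.{v₁} V] [MonoidalCategory V] [SymmetricCategory V]
  [MonoidalClosed V] {C : Type w} [EnrichedCategory V C] (F : EnrichedFunctor V Cᵒᵖ V)

/-- The degeneracy on the coefficients of the bar construction, inserting a unit. -/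
def map : {n m : ℕ} → (s : Codegen n m) → (d : Fin (m + 1) → C) →
    (barCoeff F m d ⟶ barCoeff F n (s.pull d))
  | _, _, .zero m, d => (ρ_ (barCoeff F m d)).inv ≫ barCoeff F m d ◁ eId V (d 0)
  | _, _, .succ s, d => s.map (fun k => d k.succ) ▷ (d 0 ⟶[V] d (Fin.succ 0))

end Map

end Codegen

/-! ### The inductive solution of the lifting problem in `V`. -/

section BarCoeffLifting

variable {V : Type u₁} [Category.{v₁} V] [MonoidalCategory V] [SymmetricCategory V]
  [MonoidalClosed V] [ModelCategory V] [IsMonoidalModelCategory V]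
  {C : Type w} [EnrichedCategory V C] {F F' : EnrichedFunctor V Cᵒᵖ V}

/-- The maps `F(cₙ) ⊗ ⋯ ⊗ C(c₀, c₁) ⟶ F'(cₙ) ⊗ ⋯ ⊗ C(c₀, c₁)` have the lifting property relative
to degeneracies, for all sequences `c` simultaneously. -/
theorem exists_barCoeff_lift (hHom : ∀ c d : C, IsCofibrant (c ⟶[V] d))
    (hUnit : ∀ c : C, Cofibration (eId V c)) (τ : VNatTrans V F F')
    (hτ : ∀ c : C, Cofibration (τ.app (op c))) (n : ℕ) :
    ∀ (P Q : C → V) (p : ∀ y, P y ⟶ Q y) (_ : ∀ y, (cofibrations V).rlp (p y))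
      (g : ∀ c : Fin (n + 1) → C, barCoeff F n c ⟶ P (c 0))
      (h : ∀ c : Fin (n + 1) → C, barCoeff F' n c ⟶ Q (c 0))
      (x : ∀ (m : ℕ) (_ : Codegen n m) (d : Fin (m + 1) → C), barCoeff F' m d ⟶ P (d 0))
      (_ : ∀ c, g c ≫ p (c 0) = barCoeffMap τ n c ≫ h c)
      (_ : ∀ m (s : Codegen n m) d, x m s d ≫ p (d 0) = s.map F' d ≫ h (s.pull d))
      (_ : ∀ m (s : Codegen n m) d, barCoeffMap τ m d ≫ x m s d = s.map F d ≫ g (s.pull d))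
      (_ : ∀ m m' k (a : Codegen n m) (b : Codegen m k) (a' : Codegen n m') (b' : Codegen m' k),
        CodegenSq a b a' b' → ∀ e, b.map F' e ≫ x m a (b.pull e) =
          b'.map F' e ≫ x m' a' (b'.pull e)),
      ∃ l : ∀ c : Fin (n + 1) → C, barCoeff F' n c ⟶ P (c 0),
        (∀ c, barCoeffMap τ n c ≫ l c = g c) ∧ (∀ c, l c ≫ p (c 0) = h c) ∧
          ∀ m (s : Codegen n m) d, s.map F' d ≫ l (s.pull d) = x m s d := by
  induction n with
  | zero =>
    intro P Q p hp g h x hgh hxh hxg hxx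
    -- There are no degeneracies in degree `0`, so it suffices to lift the cofibration `τ` itself.
    have key (c : Fin 1 → C) : ∃ l : barCoeff F' 0 c ⟶ P (c 0),
        barCoeffMap τ 0 c ≫ l = g c ∧ l ≫ p (c 0) = h c := by
      have hc : Cofibration (barCoeffMap τ 0 c) := hτ (c 0)
      have := hp (c 0) _ (mem_cofibrations (barCoeffMap τ 0 c))
      let s : CommSq (g c) (barCoeffMap τ 0 c) (p (c 0)) (h c) := ⟨hgh c⟩
      exact ⟨s.lift, s.fac_left, s.fac_right⟩
    choose l h₁ h₂ using key
    exact ⟨l, h₁, h₂, fun m s => nomatch s⟩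
  | succ n ih =>
    intro P Q p hp g h x hgh hxh hxg hxx
    choose R r a b hr hra hrb hext hlift using
      fun z y => exists_relative_ihom hHom hUnit z y (hp z)
    -- The restriction along the unit that the degeneracy `.zero n` prescribes for the sequence `(z,
    -- c₀, …, cₙ)`, transported along `z = c₀`.
    let t' (z : C) (c : Fin (n + 1) → C) (e : z = c 0) : barCoeff F' n c ⟶ P z :=
      x n (.zero n) c ≫ eqToHom (by rw [e])
    have t'_rfl (c : Fin (n + 1) → C) : t' (c 0) c rfl = x n (.zero n) c := Category.comp_id _
    have ht (z : C) (c : Fin (n + 1) → C) (e : z = c 0) :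
        curryRight (h (Fin.cons z c)) ≫ evalAt (eqUnit V e) (Q z) = t' z c e ≫ p z := by
      subst e
      rw [t'_rfl, eqUnit_rfl]
      exact unit_comp_eq (hxh n (.zero n) c)
    choose h' hh₁ hh₂ using fun z (c : Fin (n + 1) → C) =>
      hlift z (c 0) (barCoeff F' n c) (curryRight (h (Fin.cons z c))) (t' z c) (ht z c)
    -- The removed vertex `z` is fixed and the new targets vary with the next vertex `y`. Only the
    -- degeneracies `s.succ` are passed on; `.zero n` is already absorbed in `h'`.
    have key (z : C) := ih (fun y => (ihom (z ⟶[V] y)).obj (P z)) (R z) (r z) (hr z)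
      (fun c => curryRight (g (Fin.cons z c))) (h' z)
      (fun m s d => curryRight (x (m + 1) s.succ (Fin.cons z d)))
      (fun c => by
        refine hext z (c 0) _ _ _
          (curryRight_comp_comp (hra z _) (hh₁ z c) (hgh (Fin.cons z c))) fun e => ?_
        refine curryRight_comp_evalAt (hrb z _ e) (hh₂ z c e) ?_
        subst e
        rw [t'_rfl, eqUnit_rfl]
        exact (hxg n (.zero n) c).symm)
      -- The `b` component is the relation between `.zero` followed by `s` and `s.succ` followed by
      -- `.zero`.
      (fun m s d => by
        refine hext z (d 0) _ _ _ (curryRight_comp_comp (hra z _) (hh₁ z (s.pull d))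
          (hxh _ s.succ (Fin.cons z d))) fun e => ?_
        refine curryRight_comp_evalAt (hrb z _ e) (hh₂ z (s.pull d) e) ?_
        subst e
        rw [eqUnit_rfl]
        exact (hxx _ _ _ _ _ _ _ (.zero s) d).symm.trans (congrArg _ (t'_rfl (s.pull d)).symm))
      (fun m s d => comp_curryRight_eq (hxg _ s.succ (Fin.cons z d)))
      (fun m m' k a b a' b' sq e =>
        comp_curryRight_eq (hxx _ _ _ _ _ _ _ sq.succ (Fin.cons z e)))
    choose l h₁ h₂ h₃ using key
    refine ⟨fun c => curryRight.symm (l (c 0) fun k => c k.succ), fun c => ?_, fun c => ?_,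
      fun m s d => ?_⟩
    · cases c using Fin.consCases with | cons z c => ?_
      exact whiskerRight_comp_curryRight_symm_eq (h₁ z c)
    · cases c using Fin.consCases with | cons z c => ?_
      exact curryRight_symm_comp_eq (hra z _) (h₂ z c) (hh₁ z c)
    -- For `.zero` the prescribed value is recovered from the `b` component of `h'`, for `s.succ`
    -- from the inductive lift.
    · cases s with
      | zero =>
        have e := hrb (d 0) (d 0) rfl
        rw [eqUnit_rfl] at e
        exact unit_comp_curryRight_symm_eq e (h₂ (d 0) d) ((hh₂ (d 0) d rfl).trans (t'_rfl d))
      | succ s =>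
        cases d using Fin.consCases with | cons z d => ?_
        exact whiskerRight_comp_curryRight_symm_eq (h₃ z _ s d)

end BarCoeffLifting

/-! ### Elementary surjections as morphisms of the simplex category. -/

namespace Codegen

/-- The values of the elementary surjection `s` on the vertices `1, …, n`. -/
def tailFun : {n m : ℕ} → Codegen n m → Fin n → Fin (m + 1)
  | _, _, .zero _ => id
  | _, _, .succ s => fun k => (Fin.cases 0 s.tailFun k : Fin _).succ

lemma monotone_cases_tailFun {n m : ℕ} (s : Codegen n m) :
    Monotone (Fin.cases 0 s.tailFun : Fin (n + 1) → Fin (m + 1)) := by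
  have key {n m : ℕ} (f : Fin n → Fin (m + 1)) (hf : Monotone f) :
      Monotone (Fin.cases 0 f : Fin (n + 1) → Fin (m + 1)) := by
    intro i j hij
    cases i using Fin.cases with
    | zero => exact Fin.zero_le _
    | succ i =>
      cases j using Fin.cases with
      | zero => exact absurd hij (Fin.not_le.2 i.succ_pos)
      | succ j => exact hf (Fin.succ_le_succ_iff.1 hij)
  induction s with
  | zero m => exact key _ monotone_id
  | succ s ih => exact key _ fun i j hij => Fin.succ_le_succ_iff.2 (ih hij)

/-- The underlying order preserving map of an elementary surjection. -/
def orderHom {n m : ℕ} (s : Codegen n m) : Fin (n + 1) →o Fin (m + 1) where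
  toFun := Fin.cases 0 s.tailFun
  monotone' := s.monotone_cases_tailFun

/-- An elementary surjection as a morphism of the simplex category. -/
def hom {n m : ℕ} (s : Codegen n m) : SimplexCategory.mk n ⟶ SimplexCategory.mk m :=
  SimplexCategory.mkHom s.orderHom

lemma lt {n m : ℕ} (s : Codegen n m) : m < n := by
  induction s with
  | zero m => exact Nat.lt_succ_self m
  | succ s ih => exact Nat.succ_lt_succ ih

lemma surjective_orderHom {n m : ℕ} (s : Codegen n m) : Function.Surjective s.orderHom := by
  induction s with
  | zero m => exact fun i => ⟨i.succ, rfl⟩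
  | succ s ih =>
    intro i
    cases i using Fin.cases with
    | zero => exact ⟨0, rfl⟩
    | succ i =>
      obtain ⟨j, hj⟩ := ih i
      exact ⟨j.succ, congrArg Fin.succ hj⟩

instance {n m : ℕ} (s : Codegen n m) : Epi s.hom :=
  SimplexCategory.epi_iff_surjective.2 s.surjective_orderHom

/-- Induction on `n`: index `0` is the constructor `zero`, and shifting the index by one is the
constructor `succ`, by `Fin.succ_predAbove_succ`. -/
lemma exists_hom_eq_σ (n : ℕ) (i : Fin (n + 1)) :
    ∃ s : Codegen (n + 1) n, s.hom = SimplexCategory.σ i := by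
  suffices h : ∃ s : Codegen (n + 1) n, ∀ k, s.orderHom k = Fin.predAbove i k by
    obtain ⟨s, hs⟩ := h
    refine ⟨s, ?_⟩
    ext k : 3
    exact hs k
  induction n with
  | zero =>
    exact ⟨.zero 0, fun k => Fin.ext (by omega)⟩
  | succ n ih =>
    cases i using Fin.cases with
    | zero =>
      refine ⟨.zero _, fun k => ?_⟩
      cases k using Fin.cases with
      | zero => rfl
      | succ k => exact (Fin.predAbove_zero_succ).symm
    | succ i =>
      obtain ⟨s, hs⟩ := ih i
      refine ⟨s.succ, fun k => ?_⟩
      cases k using Fin.cases with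
      | zero => exact (Fin.predAbove_right_zero).symm
      | succ k =>
        rw [Fin.succ_predAbove_succ, ← hs]
        rfl

end Codegen

lemma CodegenSq.hom_comp {n m m' k : ℕ} {a : Codegen n m} {b : Codegen m k} {a' : Codegen n m'}
    {b' : Codegen m' k} (h : CodegenSq a b a' b') : a.hom ≫ b.hom = a'.hom ≫ b'.hom := by
  suffices h : ∀ i, b.orderHom (a.orderHom i) = b'.orderHom (a'.orderHom i) by
    ext i : 3
    exact h i
  induction h with
  | zero b =>
    intro i
    cases i using Fin.cases with
    | zero => rfl
    | succ i => rfl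
  | succ h ih =>
    intro i
    cases i using Fin.cases with
    | zero => rfl
    | succ i => exact congrArg Fin.succ (ih i)

/-! ### Latching objects through elementary degeneracies. -/

section Latching

variable {N : Type u₂} [Category.{v₂} N] [HasFiniteColimits N]

/-- An elementary surjection as an object of the latching category. -/
def Codegen.index {n m : ℕ} (s : Codegen n m) : LatchingIndex n :=
  ⟨Over.mk s.hom.op, inferInstanceAs (Epi s.hom), s.lt⟩

/-- A map `[n] → [k]` with `k < n` is not injective, so it factors as some `σ i` followed by `θ`; in
the opposite category `θ` is an arrow towards `σ i`. -/
lemma LatchingIndex.exists_factorization {n : ℕ} (j : LatchingIndex n) :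
    ∃ (m : ℕ) (s : Codegen n m), Nonempty (j ⟶ s.index) := by
  obtain ⟨⟨⟨k⟩, ⟨⟨⟩⟩, f⟩, hf, hj⟩ := j
  cases n with
  | zero => exact absurd hj (Nat.not_lt_zero _)
  | succ n =>
    obtain ⟨i, θ, hθ⟩ := SimplexCategory.eq_σ_comp_of_not_injective f.unop fun h => by
      have := Fintype.card_le_of_injective _ h
      simp only [Fintype.card_fin] at this
      exact absurd hj (by simpa using this)
    obtain ⟨s, hs⟩ := Codegen.exists_hom_eq_σ n i
    refine ⟨n, s, ⟨⟨Over.homMk θ.op ?_⟩⟩⟩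
    apply Quiver.Hom.unop_inj
    change s.hom ≫ θ = f.unop
    rw [hs, hθ]

/-- The inclusion of `X_m` into the latching object `L_n X` for an elementary surjection. -/
def Codegen.ιLatching {n m : ℕ} (s : Codegen n m) (X : SimplicialObject N) :
    X.obj (op (SimplexCategory.mk m)) ⟶ latchingObj X n :=
  colimit.ι (latchingDiagram X n) s.index

/-- The common composite surjection is an object of the latching category with arrows to both
`a.index` and `a'.index`. -/
lemma CodegenSq.map_comp_ιLatching {n m m' k : ℕ} {a : Codegen n m} {b : Codegen m k}
    {a' : Codegen n m'} {b' : Codegen m' k} (h : CodegenSq a b a' b') (X : SimplicialObject N) :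
    X.map b.hom.op ≫ a.ιLatching X = X.map b'.hom.op ≫ a'.ιLatching X := by
  let j : LatchingIndex n := ⟨Over.mk (a.hom ≫ b.hom).op,
    inferInstanceAs (Epi (a.hom ≫ b.hom)), b.lt.trans a.lt⟩
  let u : j ⟶ a.index := ⟨Over.homMk b.hom.op rfl⟩
  let u' : j ⟶ a'.index := ⟨Over.homMk b'.hom.op (Quiver.Hom.unop_inj h.hom_comp.symm)⟩
  exact (colimit.w (latchingDiagram X n) u).trans (colimit.w (latchingDiagram X n) u').symm

lemma Codegen.ιLatching_latchingMap {n m : ℕ} (s : Codegen n m) (X : SimplicialObject N) :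
    s.ιLatching X ≫ latchingMap X n = X.map s.hom.op :=
  colimit.ι_desc (latchingCocone X n) s.index

lemma Codegen.ιLatching_latchingObjMap {n m : ℕ} (s : Codegen n m) {X Y : SimplicialObject N}
    (f : X ⟶ Y) : s.ιLatching X ≫ latchingObjMap f n = f.app _ ≫ s.ιLatching Y :=
  ι_colimMap (latchingDiagramMap f n) s.index

lemma latchingObj_hom_ext {X : SimplicialObject N} {n : ℕ} {Z : N} {f g : latchingObj X n ⟶ Z}
    (h : ∀ m (s : Codegen n m), s.ιLatching X ≫ f = s.ιLatching X ≫ g) : f = g := by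
  refine colimit.hom_ext (F := latchingDiagram X n) fun j => ?_
  obtain ⟨m, s, ⟨u⟩⟩ := j.exists_factorization
  have key (f : latchingObj X n ⟶ Z) : colimit.ι (latchingDiagram X n) j ≫ f =
      (latchingDiagram X n).map u ≫ s.ιLatching X ≫ f :=
    (congrArg (· ≫ f) (colimit.w (latchingDiagram X n) u).symm).trans (Category.assoc _ _ _)
  exact (key f).trans ((congrArg _ (h m s)).trans (key g).symm)

/-- A relative latching map has the left lifting property if extension problems along elementary
degeneracies can be solved. -/
lemma hasLiftingProperty_relativeLatchingMap {A B : SimplicialObject N} (f : A ⟶ B) (n : ℕ)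
    {X Y : N} (p : X ⟶ Y)
    (H : ∀ (g : A.obj (op (SimplexCategory.mk n)) ⟶ X) (h : B.obj (op (SimplexCategory.mk n)) ⟶ Y)
      (x : ∀ m, Codegen n m → (B.obj (op (SimplexCategory.mk m)) ⟶ X))
      (_ : g ≫ p = f.app _ ≫ h) (_ : ∀ m (s : Codegen n m), x m s ≫ p = B.map s.hom.op ≫ h)
      (_ : ∀ m (s : Codegen n m), f.app _ ≫ x m s = A.map s.hom.op ≫ g)
      (_ : ∀ m m' k (a : Codegen n m) (b : Codegen m k) (a' : Codegen n m') (b' : Codegen m' k),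
        CodegenSq a b a' b' → B.map b.hom.op ≫ x m a = B.map b'.hom.op ≫ x m' a'),
      ∃ l : B.obj (op (SimplexCategory.mk n)) ⟶ X, f.app _ ≫ l = g ∧ l ≫ p = h ∧
        ∀ m (s : Codegen n m), B.map s.hom.op ≫ l = x m s) :
    HasLiftingProperty (relativeLatchingMap f n) p := by
  refine ⟨fun {t b} sq => ?_⟩
  have hl : pushout.inl (latchingMap A n) (latchingObjMap f n) ≫ relativeLatchingMap f n =
    f.app _ := pushout.inl_desc _ _ _
  have hr : pushout.inr (latchingMap A n) (latchingObjMap f n) ≫ relativeLatchingMap f n =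
    latchingMap B n := pushout.inr_desc _ _ _
  -- A map on the latching object yields a family satisfying the relations; since `H` returns a map
  -- already defined on `Bₙ`, no converse gluing over the latching object is needed.
  obtain ⟨l, h₁, h₂, h₃⟩ := H (pushout.inl _ _ ≫ t) b
    (fun m s => s.ιLatching B ≫ pushout.inr _ _ ≫ t)
    (by rw [Category.assoc, sq.w, reassoc_of% hl])
    (fun m s => by
      rw [Category.assoc, Category.assoc, sq.w, reassoc_of% hr,
        reassoc_of% s.ιLatching_latchingMap])
    (fun m s => by
      rw [← reassoc_of% s.ιLatching_latchingObjMap, ← pushout.condition_assoc,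
        reassoc_of% s.ιLatching_latchingMap])
    (fun m m' k a b a' b' h => by rw [reassoc_of% h.map_comp_ιLatching])
  refine ⟨⟨⟨l, ?_, h₂⟩⟩⟩
  refine pushout.hom_ext ?_ ?_
  · rw [reassoc_of% hl, h₁]
  · rw [reassoc_of% hr]
    refine latchingObj_hom_ext fun m s => ?_
    rw [reassoc_of% s.ιLatching_latchingMap, h₃]

end Latching

/-! ### Comparison of the recursive degeneracies with those of the bar construction. -/

section MapOrderHom

variable {V : Type u₁} [Category.{v₁} V] [MonoidalCategory V] [SymmetricCategory V]
  [MonoidalClosed V] {C : Type w} [EnrichedCategory V C] (F : EnrichedFunctor V Cᵒᵖ V)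

/-- The degeneracy `Codegen.map` with the target indexed by the composition with `s.orderHom`. -/
def Codegen.mapOrderHom : {n m : ℕ} → (s : Codegen n m) → (d : Fin (m + 1) → C) →
    (barCoeff F m d ⟶ barCoeff F n (fun i => d (s.orderHom i)))
  | _, _, .zero m, d => (ρ_ (barCoeff F m d)).inv ≫ barCoeff F m d ◁ eId V (d 0)
  | _, _, .succ s, d => s.mapOrderHom (fun k => d k.succ) ▷ (d 0 ⟶[V] d (Fin.succ 0))

/-- Both sides have the same type by unfolding `barCoeff`, but `c` and its reassembly by `Fin.cons`
agree only propositionally. -/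
lemma barCoeff_hom_eta {n : ℕ} {Z : C → V}
    (T : ∀ c : Fin (n + 2) → C, barCoeff F (n + 1) c ⟶ Z (c 0))
    (c : Fin (n + 2) → C) : T c = T (Fin.cons (c 0) fun k => c k.succ) := by
  cases c using Fin.consCases with | cons z c => rfl

/-- The sequences `s.pull d` and `d ∘ s.orderHom` are not definitionally equal, so the two
degeneracies are compared after composition with an arbitrary family `T`. The induction transposes
the last factor, which changes `Z`. -/
lemma Codegen.mapOrderHom_comp {n m : ℕ} (s : Codegen n m) (Z : C → V)
    (T : ∀ c : Fin (n + 1) → C, barCoeff F n c ⟶ Z (c 0)) (d : Fin (m + 1) → C) :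
    s.mapOrderHom F d ≫ T (fun i => d (s.orderHom i)) = s.map F d ≫ T (s.pull d) := by
  induction s generalizing Z with
  | zero m => exact congrArg (_ ≫ ·) (barCoeff_hom_eta F T _)
  | @succ n m s ih =>
    have h := ih (fun y => (ihom (d 0 ⟶[V] y)).obj (Z (d 0)))
      (fun c => curryRight (T (Fin.cons (d 0) c))) (fun k => d k.succ)
    have h' := (curryRight_whiskerRight_comp _ _).trans
      (h.trans (curryRight_whiskerRight_comp _ _).symm)
    exact (congrArg (_ ≫ ·) (barCoeff_hom_eta F T _)).trans (curryRight.injective h')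

/-- The unit inserted in `h` is absorbed into `C(x, y)` by the unit law `unit_step`, leaving `t`. -/
lemma id_aux_comp {A B D : V} (x y : C) (s : A ⟶ B ⊗ (y ⟶[V] y)) (r : B ⟶ D) (t : A ⟶ D)
    (h : s ≫ r ▷ (y ⟶[V] y) = ((ρ_ A).inv ≫ A ◁ eId V y) ≫ t ▷ (y ⟶[V] y)) :
    (s ▷ (x ⟶[V] y) ≫ (α_ _ _ _).hom ≫ B ◁ homComp V x y y) ≫ r ▷ (x ⟶[V] y) =
      t ▷ (x ⟶[V] y) := by
  have h₁ : (s ▷ (x ⟶[V] y) ≫ (α_ _ _ _).hom ≫ B ◁ homComp V x y y) ≫ r ▷ (x ⟶[V] y) =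
      (s ≫ r ▷ (y ⟶[V] y)) ▷ (x ⟶[V] y) ≫ (α_ _ _ _).hom ≫ D ◁ homComp V x y y := by
    simp only [comp_whiskerRight, Category.assoc]
    rw [whisker_exchange, associator_naturality_left_assoc]
  rw [h₁, h, ← unit_naturality, comp_whiskerRight, Category.assoc, unit_step, Category.comp_id]

lemma reindex₀_id_succ (n : ℕ) (c : Fin (n + 2) → C) :
    reindex₀ F c (n + 1) OrderHom.id = 𝟙 (barCoeff F (n + 1) c) := by
  change (split₀ F n (fun k => c k.succ) 0 ▷ (c 0 ⟶[V] c (Fin.succ 0)) ≫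
      (α_ _ _ _).hom ≫ tailCoeff F n (fun k => c k.succ) 0 ◁
        homComp V (c 0) (c (Fin.succ 0)) (c (Fin.succ 0))) ≫
      reindex₀ F c n (ordSucc OrderHom.id) ▷ (c 0 ⟶[V] c (Fin.succ 0)) = _
  rw [reindex₀_ordSucc]
  exact id_aux _ _ _ _ (split₀_reindex₀_id F n _)

/-- In essence `reindex₀` for `s.orderHom` is `s.mapOrderHom`. The unit is kept on both sides
because `tailCoeff F m d 0` unfolds to `barCoeff F m d` only after a case split on `m`, and because
`id_aux_comp` consumes this form. -/
lemma Codegen.split₀_reindex₀ {n m : ℕ} (s : Codegen n m) (d : Fin (m + 1) → C) :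
    split₀ F m d 0 ≫ reindex₀ F d n s.orderHom ▷ (d 0 ⟶[V] d 0) =
      ((ρ_ (barCoeff F m d)).inv ≫ barCoeff F m d ◁ eId V (d 0)) ≫
        s.mapOrderHom F d ▷ (d 0 ⟶[V] d 0) := by
  induction s with
  | zero m =>
    cases m with
    | zero =>
      exact congrArg (fun t => ((ρ_ (barCoeff F 0 d)).inv ≫ barCoeff F 0 d ◁ eId V (d 0)) ≫
        (((ρ_ (barCoeff F 0 d)).inv ≫ barCoeff F 0 d ◁ eId V (d 0)) ≫ t) ▷ (d 0 ⟶[V] d 0))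
          (id_whiskerRight _ _) |>.trans (by rw [Category.comp_id]; rfl)
    | succ m =>
      have h : reindex₀ F d (m + 2) (Codegen.zero (m + 1)).orderHom =
          (Codegen.zero (m + 1)).mapOrderHom F d := by
        refine (congrArg (fun t => ((ρ_ (barCoeff F (m + 1) d)).inv ≫
          barCoeff F (m + 1) d ◁ eId V (d 0)) ≫ t ▷ (d 0 ⟶[V] d 0))
            (reindex₀_id_succ F m d)).trans ?_
        exact (congrArg (_ ≫ ·) (id_whiskerRight _ _)).trans (Category.comp_id _)
      exact congrArg (fun t => ((ρ_ (barCoeff F (m + 1) d)).inv ≫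
        barCoeff F (m + 1) d ◁ eId V (d 0)) ≫ t ▷ (d 0 ⟶[V] d 0)) h
  | @succ n m s ih =>
    have h : reindex₀ F d (n + 1) s.succ.orderHom = s.succ.mapOrderHom F d := by
      -- On the vertices after the first, `s.succ.orderHom` is `ordSucc s.orderHom`, so
      -- `reindex₀_ordSucc` reduces to the shorter sequence.
      change (split₀ F m (fun k => d k.succ) 0 ▷ (d 0 ⟶[V] d (Fin.succ 0)) ≫
        (α_ _ _ _).hom ≫ tailCoeff F m (fun k => d k.succ) 0 ◁
          homComp V (d 0) (d (Fin.succ 0)) (d (Fin.succ 0))) ≫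
        reindex₀ F d n (ordSucc s.orderHom) ▷ (d 0 ⟶[V] d (Fin.succ 0)) = _
      rw [reindex₀_ordSucc]
      exact id_aux_comp _ _ _ _ _ (ih _)
    exact congrArg (fun t => ((ρ_ (barCoeff F (m + 1) d)).inv ≫
      barCoeff F (m + 1) d ◁ eId V (d 0)) ≫ t ▷ (d 0 ⟶[V] d 0)) h

end MapOrderHom

/-! ### Enriched homs out of cofibrant objects. -/

section EnrichedModel

variable {V : Type u₁} [Category.{v₁} V] [MonoidalCategory V] {N : Type u₂} [Category.{v₂} N]
  [EnrichedOrdinaryCategory V N]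

/-- Morphisms `v ⟶ N(x, y)` correspond to morphisms `x ⟶ y ^ v`. -/
def CotensorData.homEquiv [SymmetricCategory V] [MonoidalClosed V] {v : V} {y : N}
    (T : CotensorData V v y) (x : N) : (v ⟶ (x ⟶[V] y)) ≃ (x ⟶ T.obj) :=
  MonoidalClosed.curryHomEquiv'.trans ((T.homIso x).symm.homToEquiv.trans (eHomEquiv V).symm)

/-- The pullback-power of `⊥ ⟶ A` and `p` is a trivial fibration. By cotensors, maps `v ⟶ N(⊥, y)`
are maps from `⊥` to `y ^ v`, so `N(⊥, y)` is terminal and the pullback reduces to `N(A, Y)`. -/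
lemma rlp_eHomWhiskerLeft [SymmetricCategory V] [MonoidalClosed V] [EnrichedCotensored V N]
    [ModelCategory V] [ModelCategory N] [IsEnrichedModelCategory V N] (A : N) [IsCofibrant A]
    {X Y : N} (p : X ⟶ Y) (hp : trivialFibrations N p) :
    (cofibrations V).rlp (eHomWhiskerLeft V A p) := by
  obtain ⟨_, _⟩ := (mem_trivialFibrations_iff p).1 hp
  have h₁ : Fibration (pullbackPower V (initial.to A) p) :=
    IsEnrichedModelCategory.fibration_pullbackPower _ _
  have h₂ : WeakEquivalence (pullbackPower V (initial.to A) p) :=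
    IsEnrichedModelCategory.weakEquivalence_pullbackPower _ _ (Or.inr inferInstance)
  have e (v : V) (y : N) : (v ⟶ ((⊥_ N) ⟶[V] y)) ≃ ((⊥_ N) ⟶ _) :=
    (EnrichedCotensored.cotensor v y).homEquiv (⊥_ N)
  have hs (v : V) (y : N) : Subsingleton (v ⟶ ((⊥_ N) ⟶[V] y)) := (e v y).subsingleton
  have hfst : pullbackPower V (initial.to A) p ≫ pullback.fst _ _ = eHomWhiskerLeft V A p :=
    pullback.lift_fst _ _ _
  intro v v' j hj
  refine ⟨fun {f g} sq => ?_⟩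
  have : Cofibration j := ⟨hj⟩
  let t : v' ⟶ ((⊥_ N) ⟶[V] X) := (e v' X).symm (initial.to _)
  let sq' : CommSq f j (pullbackPower V (initial.to A) p)
      (pullback.lift g t ((hs _ _).elim _ _)) := by
    refine ⟨pullback.hom_ext ?_ ((hs _ _).elim _ _)⟩
    rw [Category.assoc, Category.assoc, hfst, pullback.lift_fst, sq.w]
  refine ⟨⟨⟨sq'.lift, sq'.fac_left, ?_⟩⟩⟩
  have := sq'.fac_right =≫ pullback.fst _ _
  rwa [Category.assoc, hfst, pullback.lift_fst] at this

end EnrichedModel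

/-! ### Maps out of the bar construction in terms of coefficients. -/

section BarHom

variable {V : Type u₁} [Category.{v₁} V] [MonoidalCategory V] [SymmetricCategory V]
  [MonoidalClosed V] {N : Type u₂} [Category.{v₂} N] [EnrichedOrdinaryCategory V N]
  [EnrichedTensored V N] {C : Type w} [EnrichedCategory V C] (G : EnrichedFunctor V C N)
  (F F' : EnrichedFunctor V Cᵒᵖ V)

lemma bar_id_aux_comp {A B D : V} (x : C) (s : A ⟶ B ⊗ (x ⟶[V] x)) (r : B ⟶ D) (t : A ⟶ D)
    (h : s ≫ r ▷ (x ⟶[V] x) = ((ρ_ A).inv ≫ A ◁ eId V x) ≫ t ▷ (x ⟶[V] x)) :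
    vTensorMap s (G.obj x) ≫ functorAct G B x x ≫ vTensorMap r (G.obj x) =
      vTensorMap t (G.obj x) := by
  rw [← functorAct_naturality, ← reassoc_of% vTensorMap_comp, h, vTensorMap_comp, Category.assoc,
    functorAct_naturality, reassoc_of% functorAct_id]

/-- An elementary surjection fixes `0`, so only the inserted unit acts on `G`, and `functorAct_id`
cancels it. -/
lemma Codegen.barTermMap_eq {n m : ℕ} (s : Codegen n m) (d : Fin (m + 1) → C) :
    barTermMap G F s.orderHom d = vTensorMap (s.mapOrderHom F d) (G.obj (d 0)) :=
  bar_id_aux_comp G (d 0) _ _ _ (s.split₀_reindex₀ F d)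

variable [HasColimitsOfSize.{w, w} N]

/-- The inclusion of a summand of `Bₙ(F, C, G)`. -/
def barι (n : ℕ) (c : Fin (n + 1) → C) :
    vTensor (barCoeff F n c) (G.obj (c 0)) ⟶ (bar G F).obj (op (SimplexCategory.mk n)) :=
  Limits.Sigma.ι (fun c => barTerm G F n c) c

lemma Codegen.barι_map {n m : ℕ} (s : Codegen n m) (d : Fin (m + 1) → C) :
    barι G F m d ≫ (bar G F).map s.hom.op =
      vTensorMap (s.mapOrderHom F d) (G.obj (d 0)) ≫ barι G F n (fun i => d (s.orderHom i)) := by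
  rw [← s.barTermMap_eq]
  exact Sigma.ι_desc _ d

variable {F F'} in
lemma barι_barMap (τ : VNatTrans V F F') (n : ℕ) (c : Fin (n + 1) → C) :
    barι G F n c ≫ (barMap G τ).app _ =
      vTensorMap (barCoeffMap τ n c) (G.obj (c 0)) ≫ barι G F' n c :=
  Sigma.ι_map _ c

/-- Morphisms from `Bₙ(F, C, G)` to `Z`, in terms of the coefficients. -/
def barHomEquiv (n : ℕ) (Z : N) : ((bar G F).obj (op (SimplexCategory.mk n)) ⟶ Z) ≃
    ∀ c : Fin (n + 1) → C, barCoeff F n c ⟶ (G.obj (c 0) ⟶[V] Z) where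
  toFun φ c := vTensorDesc.symm (barι G F n c ≫ φ)
  invFun T := Limits.Sigma.desc (f := fun c => barTerm G F n c) fun c => vTensorDesc (T c)
  left_inv _ := Sigma.hom_ext (f := fun c => barTerm G F n c) _ _ fun c =>
    (Sigma.ι_desc _ c).trans (vTensorDesc.apply_symm_apply _)
  right_inv _ := funext fun c =>
    (Equiv.symm_apply_eq _).2 (Sigma.ι_desc (f := fun c => barTerm G F n c) _ c)

lemma vTensorDesc_barHomEquiv {n : ℕ} {Z : N}
    (φ : (bar G F).obj (op (SimplexCategory.mk n)) ⟶ Z) (c : Fin (n + 1) → C) :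
    vTensorDesc (barHomEquiv G F n Z φ c) = barι G F n c ≫ φ :=
  vTensorDesc.apply_symm_apply _

lemma barHomEquiv_comp {n : ℕ} {Z Z' : N} (φ : (bar G F).obj (op (SimplexCategory.mk n)) ⟶ Z)
    (f : Z ⟶ Z') (c : Fin (n + 1) → C) : barHomEquiv G F n Z' (φ ≫ f) c =
      barHomEquiv G F n Z φ c ≫ eHomWhiskerLeft V (G.obj (c 0)) f := by
  apply vTensorDesc.injective
  rw [← vTensorDesc_comp, vTensorDesc_barHomEquiv, vTensorDesc_barHomEquiv, Category.assoc]

/-- This puts degeneracies into the form required by `exists_barCoeff_lift`, passing from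
`s.mapOrderHom` to `s.map`. -/
lemma barHomEquiv_map {n m : ℕ} (s : Codegen n m) {Z : N}
    (φ : (bar G F).obj (op (SimplexCategory.mk n)) ⟶ Z) (d : Fin (m + 1) → C) :
    barHomEquiv G F m Z ((bar G F).map s.hom.op ≫ φ) d =
      s.map F d ≫ barHomEquiv G F n Z φ (s.pull d) := by
  rw [← s.mapOrderHom_comp F (fun y => G.obj y ⟶[V] Z) (barHomEquiv G F n Z φ)]
  apply vTensorDesc.injective
  rw [vTensorDesc_barHomEquiv, reassoc_of% s.barι_map]
  refine (Category.assoc _ _ _).trans ?_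
  exact (congrArg (_ ≫ ·) (vTensorDesc_barHomEquiv G F φ _).symm).trans
    (vTensorMap_desc (s.mapOrderHom F d) (barHomEquiv G F n Z φ (fun i => d (s.orderHom i))))

variable {F F'} in
lemma barHomEquiv_barMap (τ : VNatTrans V F F') {n : ℕ} {Z : N}
    (φ : (bar G F').obj (op (SimplexCategory.mk n)) ⟶ Z) (c : Fin (n + 1) → C) :
    barHomEquiv G F n Z ((barMap G τ).app _ ≫ φ) c =
      barCoeffMap τ n c ≫ barHomEquiv G F' n Z φ c := by
  apply vTensorDesc.injective
  rw [vTensorDesc_barHomEquiv, ← vTensorMap_desc, vTensorDesc_barHomEquiv,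
    reassoc_of% barι_barMap]

end BarHom

end

end EnrichedBar

/-! ### Reduction of the theorem to the lifting problem in `V`. -/

open EnrichedBar in
theorem mainTheorem6
    {V : Type u₁} [Category.{v₁} V] [MonoidalCategory V] [SymmetricCategory V] [MonoidalClosed V]
    [HasLimitsOfSize.{w, w} V] [HasColimitsOfSize.{w, w} V]
    [ModelCategory V] [IsMonoidalModelCategory V]
    {N : Type u₂} [Category.{v₂} N] [EnrichedOrdinaryCategory V N]
    [HasLimitsOfSize.{w, w} N] [HasColimitsOfSize.{w, w} N]
    [EnrichedTensored V N] [EnrichedCotensored V N]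
    [ModelCategory N] [IsEnrichedModelCategory V N]
    {C : Type w} [EnrichedCategory V C]
    (hHom : ∀ c d : C, IsCofibrant (c ⟶[V] d))
    (hUnit : ∀ c : C, Cofibration (eId V c))
    (F F' : EnrichedFunctor V Cᵒᵖ V) (τ : VNatTrans V F F')
    (hτ : ∀ c : C, Cofibration (τ.app (op c)))
    (G : EnrichedFunctor V C N) (hG : ∀ c : C, IsCofibrant (G.obj c)) :
    IsReedyCofibration (barMap G τ) := by
  intro n
  refine ⟨?_⟩
  rw [← MorphismProperty.llp_eq_of_wfs (cofibrations N) (trivialFibrations N)]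
  intro X Y p hp
  refine hasLiftingProperty_relativeLatchingMap _ n p fun g h x hgh hxh hxg hxx => ?_
  -- Each compatibility of `g`, `h` and `x` transposes to its counterpart for coefficients, with `P
  -- y = N(G y, X)` and `Q y = N(G y, Y)`.
  obtain ⟨l, h₁, h₂, h₃⟩ := exists_barCoeff_lift hHom hUnit τ hτ n (fun y => G.obj y ⟶[V] X)
    (fun y => G.obj y ⟶[V] Y) (fun y => eHomWhiskerLeft V (G.obj y) p)
    (fun y => rlp_eHomWhiskerLeft (G.obj y) p hp) (barHomEquiv G F n X g)
    (barHomEquiv G F' n Y h) (fun m s => barHomEquiv G F' m X (x m s))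
    (fun c => by rw [← barHomEquiv_comp, hgh, barHomEquiv_barMap])
    (fun m s d => by rw [← barHomEquiv_comp, hxh, barHomEquiv_map])
    (fun m s d => by rw [← barHomEquiv_barMap, hxg, barHomEquiv_map])
    (fun m m' k a b a' b' sq e => by
      rw [← barHomEquiv_map, hxx _ _ _ _ _ _ _ sq, barHomEquiv_map])
  refine ⟨(barHomEquiv G F' n X).symm l, (barHomEquiv G F n X).injective (funext fun c => ?_),
    (barHomEquiv G F' n Y).injective (funext fun c => ?_),
    fun m s => (barHomEquiv G F' m X).injective (funext fun d => ?_)⟩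
  · rw [barHomEquiv_barMap, Equiv.apply_symm_apply, h₁]
  · rw [barHomEquiv_comp, Equiv.apply_symm_apply, h₂]
  · rw [barHomEquiv_map, Equiv.apply_symm_apply, h₃]
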